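/- **Setting.** Let $m\ge 1$ and let $(p_i,y_i)$, $i=1,\dots,m$, be calibration points with $k$ classes: $p_i\in\Delta^{k-1}$ (the probability simplex) and $y_i\in\{0,1\}^k$ one-hot. Let $\sigma_i$ be an order permutation of $p_i$, i.e. $(p_i)_{\sigma_i^{-1}(1)}\ge\cdots\ge (p_i)_{\sigma_i^{-1}(k)}$ (any choice in case of ties). For $1\le r\le k-1$ put $$q_{i,r}=\sum_{\sigma_i(j)\le r}(p_i)_j,\qquad \tilde y_{i,r}=\sum_{\sigma_i(j)\le r}(y_i)_j\in\{0,1\}.$$ The sorted cumulative isotonic regression problem is to minimise $$-\sum_{i=1}^m\sum_{r=1}^{k-1}\Big(\tilde y_{i,r}\log g(q_{i,r},r)+(1-\tilde y_{i,r})\log\big(1-g(q_{i,r},r)\big)\Big)\in[0,\infty]$$ (with $\log 0=-\infty$, $0\cdot\infty=0$) over all $g:[0,1]\times\{1,\dots,k-1\}\to[0,1]$ with $g(q,r)\le g(s,t)$ whenever $q\le s$ and $r\le t$. **Method.** Compute the points $(q_{i,r},r)$, sort them by $q$, then by $r$, and pool the data at equal positions into one point with weight the total number of data and value their mean. This gives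 a list $\mathcal X$ of at most $N=m(k-1)$ weighted points. Split recursively: for a nonempty sublist $X=(x_1,\dots,x_n)$, with $x_i$ of rank $l_i$, value $y_i$ and weight $w_i>0$, let $b=\mathrm{Avg}(X)=\sum w_iy_i/\sum w_i$ and compute, for $i=n,\dots,1$ and $j=1,\dots,k$, with $M[n+1,\cdot]=0$ and $v_i=w_i(y_i-b)$, $$M[i,j]=\begin{cases}M[i+1,j]+v_i,& j\le l_i,\\ \max\big(M[i+1,j],\,M[i+1,l_i]+v_i\big),& j>l_i,\end{cases}$$ and trace the choices back from column $k$ to obtain a subset $U\subseteq X$. If $U=\emptyset$ or $U=X$, assign the value $b$ to all of $X$; otherwise treat $X\setminus U$ and $U$ in the same way. **Proposition.** There is an absolute constant $C$ such that the following holds, where time is the number of elementary steps (arithmetic operations and comparisons of two real numbers or two indices, creations of a list cell, function calls). 1. For every nonempty list $X$ of $n$ weighted points at distinct positions in $\mathbb R\times\{1,\dots,k-1\}$, sorted as above, with real values and positive weights, the dynamic program returns in at most $C\,n\,k$ steps a maximal upper set $U$ of $X$ for the coordinatewise order, i.e. an upper set maximising $H_X(U)=\sum_{x_i\in U}w_i(y_i-\mathrm{Avg}(X))$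 among all upper sets of $X$. If $L=X\setminus U$ and $U$ are both nonempty, then $(L,U)$ is a projection pair: $L$ is a lower set, $U$ is an upper set, and there is $d\in\mathbb R$ such that the weighted least-squares isotonic regression on $L$ is at most $d$ everywhere on $L$ and that on $U$ is at least $d$ everywhere on $U$. Since $\mathcal X$ is such a list with at most $N=m(k-1)$ points, every split costs $O(Nk)$. 2. For every calibration set as above, the method, from the calibration set to the fitted values, takes at most $C\,m^2k^4$ steps, and its output is exact: it is the table of the values, at the positions $(q_{i,r},r)$, of a minimiser $g$ of the sorted cumulative isotonic regression problem. -/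

import Mathlib

namespace SCIR

/-! ### The optimisation problem -/

section Problem

/-- `σ` orders the `k` scores `p`: `p (σ⁻¹ 0) ≥ p (σ⁻¹ 1) ≥ ⋯`.  Ranks inside `Fin k` are counted
from `0`, so class `j` has rank `σ j + 1`. -/
def IsOrderPerm {k : ℕ} (p : Fin k → ℝ) (σ : Equiv.Perm (Fin k)) : Prop :=
  Antitone fun r => p (σ.symm r)

/-- The one-hot vector of the class `c`. -/
def oneHot {k : ℕ} (c : Fin k) : Fin k → ℝ := Pi.single c 1

/-- `∑_{rank j ≤ r} v_j`. -/
def topSum {k : ℕ} (σ : Equiv.Perm (Fin k)) (v : Fin k → ℝ) (r : ℕ) : ℝ :=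
  ∑ j with (σ j : ℕ) + 1 ≤ r, v j

/-- The domain `[0,1] × {1, …, k-1}`; it carries the coordinatewise order of `ℝ × ℕ`. -/
def domain (k : ℕ) : Set (ℝ × ℕ) := Set.Icc 0 1 ×ˢ Set.Ico 1 k

/-- `-log t ∈ [0,∞]` for `t ∈ [0,1]`, with `-log 0 = ∞`. -/
noncomputable def negLog (t : ℝ) : ENNReal :=
  if 0 < t then ENNReal.ofReal (-Real.log t) else ⊤

/-- The Bernoulli negative log-likelihood of `g` on the aggregated sorted cumulative data of the
`m` calibration points `(p i, y i)`; one term for every `i` and every rank `1 ≤ r ≤ k-1`.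
In `[0,∞]` one has `0 * ∞ = 0`. -/
noncomputable def nll {m k : ℕ} (p y : Fin m → Fin k → ℝ) (σ : Fin m → Equiv.Perm (Fin k))
    (g : ℝ × ℕ → ℝ) : ENNReal :=
  ∑ i, ∑ r ∈ Finset.Ico 1 k,
    (ENNReal.ofReal (topSum (σ i) (y i) r) * negLog (g (topSum (σ i) (p i) r, r)) +
      ENNReal.ofReal (1 - topSum (σ i) (y i) r) * negLog (1 - g (topSum (σ i) (p i) r, r)))

/-- Probability-valued functions that are isotonic for the coordinatewise order. -/
def Feasible (k : ℕ) (g : ℝ × ℕ → ℝ) : Prop :=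
  Set.MapsTo g (domain k) (Set.Icc 0 1) ∧ MonotoneOn g (domain k)

/-- `g` solves the sorted cumulative isotonic regression problem. -/
def IsSolution {m k : ℕ} (p y : Fin m → Fin k → ℝ) (σ : Fin m → Equiv.Perm (Fin k))
    (g : ℝ × ℕ → ℝ) : Prop :=
  Feasible k g ∧ ∀ h, Feasible k h → nll p y σ g ≤ nll p y σ h

end Problem

/-! ### Counting elementary steps

A computation is carried out in the monad `Timed`, which adds up elementary steps.  One step is:
one arithmetic operation or comparison on two field elements or on two indices; the creation of
one list cell; one call of a function together with the case distinction on its arguments and the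
access to the components of a pair or record.  There is no other access to list entries, so that
reading the `n`-th entry of a list costs time proportional to `n`. -/

structure Timed (α : Type) where
  val : α
  steps : ℕ

instance : Monad Timed where
  pure a := ⟨a, 0⟩
  bind x f := ⟨(f x.val).val, x.steps + (f x.val).steps⟩

/-- The charge for one function call. -/
def tick : Timed Unit := ⟨(), 1⟩

section Primitives

variable {R : Type} [Field R] [LinearOrder R]

def addT (a b : R) : Timed R := ⟨a + b, 1⟩
def subT (a b : R) : Timed R := ⟨a - b, 1⟩
def mulT (a b : R) : Timed R := ⟨a * b, 1⟩
def divT (a b : R) : Timed R := ⟨a / b, 1⟩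
def ltT (a b : R) : Timed Bool := ⟨decide (a < b), 1⟩
def succT (a : ℕ) : Timed ℕ := ⟨a + 1, 1⟩
def predT (a : ℕ) : Timed ℕ := ⟨a - 1, 1⟩
def natLtT (a b : ℕ) : Timed Bool := ⟨decide (a < b), 1⟩
def natLeT (a b : ℕ) : Timed Bool := ⟨decide (a ≤ b), 1⟩
def natEqT (a b : ℕ) : Timed Bool := ⟨decide (a = b), 1⟩
def consT {α : Type} (a : α) (l : List α) : Timed (List α) := ⟨a :: l, 1⟩

end Primitives

section Lists

variable {α : Type}

def appendT : List α → List α → Timed (List α)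
  | [], l => do
    tick
    return l
  | a :: as, l => do
    tick
    let t ← appendT as l
    consT a t

/-- Insertion into a list, `before a b` telling whether `a` is to be placed in front of `b`. -/
def insertT (before : α → α → Timed Bool) (a : α) : List α → Timed (List α)
  | [] => do
    tick
    consT a []
  | b :: bs => do
    tick
    if ← before a b then
      consT a (b :: bs)
    else
      let t ← insertT before a bs
      consT b t

def sortT (before : α → α → Timed Bool) : List α → Timed (List α)
  | [] => do
    tick
    return []
  | a :: as => do
    tick
    let t ← sortT before as
    insertT before a t

/-- The `n`-th entry of a list, counted from `1`. -/
def nthT (dflt : α) : List α → ℕ → Timed α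
  | [], _ => do
    tick
    return dflt
  | a :: as, n => do
    tick
    if ← natLeT n 1 then
      return a
    else
      let n' ← predT n
      nthT dflt as n'

/-- `n` copies of `a`. -/
def replicateT (a : α) : ℕ → Timed (List α)
  | 0 => do
    tick
    return []
  | n + 1 => do
    tick
    let t ← replicateT a n
    consT a t

end Lists

/-! ### The algorithm

It is written for an arbitrary ordered field `R`, which it accesses only through the charged
primitives. -/

/-- A class of a calibration point: its score `p_j`, its label `y_j`, and a key that is consulted
only to break ties between equal scores. -/
structure ClassEntry (R : Type) where
  score : R
  tie : ℕ
  label : R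

/-- A weighted data point: position `(q, r)`, value `y`, weight `w`. -/
structure Pt (R : Type) where
  q : R
  r : ℕ
  y : R
  w : R

section Algorithm

variable {R : Type} [Field R] [LinearOrder R]

/-- Decreasing score, ties broken by the key. -/
def classBeforeT (a b : ClassEntry R) : Timed Bool := do
  tick
  if ← ltT b.score a.score then
    return true
  else if ← ltT a.score b.score then
    return false
  else
    natLtT a.tie b.tie

/-- Increasing first coordinate, then increasing second coordinate. -/
def ptBeforeT (a b : Pt R) : Timed Bool := do
  tick
  if ← ltT a.q b.q then
    return true
  else if ← ltT b.q a.q then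
    return false
  else
    natLtT a.r b.r

def samePosT (a b : Pt R) : Timed Bool := do
  tick
  if ← ltT a.q b.q then
    return false
  else if ← ltT b.q a.q then
    return false
  else
    natEqT a.r b.r

/-- Cumulative sums along the sorted classes; the last rank is left out. The arguments `r`, `q`, `y`
are the rank and the sums reached so far. -/
def cumulateT (r : ℕ) (q y : R) : List (ClassEntry R) → Timed (List (Pt R))
  | [] => do
    tick
    return []
  | [_] => do
    tick
    return []
  | e :: e' :: es => do
    tick
    let r' ← succT r
    let q' ← addT q e.score
    let y' ← addT y e.label
    let t ← cumulateT r' q' y' (e' :: es)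
    consT ⟨q', r', y', 1⟩ t

/-- All sorted cumulative data of a list of calibration points. -/
def collectT : List (List (ClassEntry R)) → Timed (List (Pt R))
  | [] => do
    tick
    return []
  | s :: ss => do
    tick
    let s' ← sortT classBeforeT s
    let c ← cumulateT 0 0 0 s'
    let t ← collectT ss
    appendT c t

/-- Two data points at the same position are replaced by one, with the total weight and the
weighted mean of the values. -/
def poolT (a b : Pt R) : Timed (Pt R) := do
  tick
  let w ← addT a.w b.w
  let s ← mulT a.w a.y
  let t ← mulT b.w b.y
  let u ← addT s t
  let y ← divT u w
  return ⟨a.q, a.r, y, w⟩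

/-- In a sorted list, pool all data points that share their position. -/
def mergeT : List (Pt R) → Timed (List (Pt R))
  | [] => do
    tick
    return []
  | x :: xs => do
    tick
    match ← mergeT xs with
    | [] => consT x []
    | z :: zs =>
      if ← samePosT x z then
        let u ← poolT x z
        consT u zs
      else
        consT x (z :: zs)

/-- The pooled data set, sorted by the first, then by the second coordinate. -/
def aggregateT (V : List (List (ClassEntry R))) : Timed (List (Pt R)) := do
  tick
  let c ← collectT V
  let s ← sortT ptBeforeT c
  mergeT s

/-- `(∑ w y, ∑ w)`. -/
def sumsT : List (Pt R) → Timed (R × R)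
  | [] => do
    tick
    return (0, 0)
  | x :: xs => do
    tick
    let s ← sumsT xs
    let t ← mulT x.w x.y
    let a ← addT t s.1
    let b ← addT x.w s.2
    return (a, b)

/-- The weighted mean. -/
def avgT (X : List (Pt R)) : Timed R := do
  tick
  let s ← sumsT X
  divT s.1 s.2

/-- Row `i` of the tables `M` and `R` from row `i+1` of `M`, for a point of rank `l`: here
`v = w_i (y_i - b)` and `inc = M[i+1, l] + v`; the column index `j` runs along the row. -/
def rowT (l : ℕ) (v inc : R) : ℕ → List R → Timed (List R × List ℕ)
  | _, [] => do
    tick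
    return ([], [])
  | j, mj :: ms => do
    tick
    let j' ← succT j
    let t ← rowT l v inc j' ms
    if ← natLeT j l then
      let a ← addT mj v
      let row ← consT a t.1
      let choice ← consT j t.2
      return (row, choice)
    else if ← ltT inc mj then
      let row ← consT mj t.1
      let choice ← consT j t.2
      return (row, choice)
    else
      let row ← consT inc t.1
      let choice ← consT l t.2
      return (row, choice)

/-- The first row of `M` and all rows of `R`, with `c` columns and reference value `b`. -/
def tableT (b : R) (c : ℕ) : List (Pt R) → Timed (List R × List (List ℕ))
  | [] => do
    tick
    let z ← replicateT 0 c
    return (z, [])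
  | x :: xs => do
    tick
    let t ← tableT b c xs
    let d ← subT x.y b
    let v ← mulT x.w d
    let a ← nthT 0 t.1 x.r
    let inc ← addT a v
    let u ← rowT x.r v inc 1 t.1
    let choices ← consT u.2 t.2
    return (u.1, choices)

/-- Trace the choices back from column `j`; the points are distributed to the complement (first
component) and to the upper set (second component). -/
def traceT : ℕ → List (Pt R) → List (List ℕ) → Timed (List (Pt R) × List (Pt R))
  | j, x :: xs, choice :: choices => do
    tick
    let j' ← nthT 0 choice j
    let t ← traceT j' xs choices
    if ← natLeT j' x.r then
      let U ← consT x t.2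
      return (t.1, U)
    else
      let L ← consT x t.1
      return (L, t.2)
  | _, _, _ => do
    tick
    return ([], [])

/-- The grid dynamic program with columns `1, …, c`: it returns a maximal upper set as the second
component and its complement as the first. -/
def maxUpperSetT (c : ℕ) (X : List (Pt R)) : Timed (List (Pt R) × List (Pt R)) := do
  tick
  let b ← avgT X
  let t ← tableT b c X
  traceT c X t.2

/-- Assign the value `b` to all positions of a list. -/
def constantT (b : R) : List (Pt R) → Timed (List ((R × ℕ) × R))
  | [] => do
    tick
    return []
  | x :: xs => do
    tick
    let t ← constantT b xs
    consT ((x.q, x.r), b) t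

/-- Recursive splitting along maximal upper sets; when one of the two parts is empty, the mean is
assigned.  The first explicit argument bounds the depth of the recursion for the sake of
termination; since both parts of a split are smaller, the length of the list is large enough. -/
def splitSolveT (c : ℕ) : ℕ → List (Pt R) → Timed (List ((R × ℕ) × R))
  | 0, _ => return []
  | depth + 1, X => do
    tick
    match ← maxUpperSetT c X with
    | (l :: L, u :: U) => do
      let fL ← splitSolveT c depth (l :: L)
      let fU ← splitSolveT c depth (u :: U)
      appendT fL fU
    | _ => do
      let b ← avgT X
      constantT b X

/-- The whole method for `k` classes: from the calibration set to the list of the fitted values,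
each with its position. -/
def fitT (k : ℕ) (V : List (List (ClassEntry R))) : Timed (List ((R × ℕ) × R)) := do
  tick
  let X ← aggregateT V
  splitSolveT k X.length X

end Algorithm

/-- The calibration set as the algorithm receives it; `σ` serves only to break ties. -/
def inputData {m k : ℕ} (p y : Fin m → Fin k → ℝ) (σ : Fin m → Equiv.Perm (Fin k)) :
    List (List (ClassEntry ℝ)) :=
  List.ofFn fun i => List.ofFn fun j => ⟨p i j, σ i j, y i j⟩

/-! ### Upper sets and projection pairs

Finite sets of data points are given as duplicate-free lists, their subsets as sublists. -/

section Sets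

def Pt.pos (x : Pt ℝ) : ℝ × ℕ := (x.q, x.r)

/-- The inputs of the dynamic program: points at distinct positions, sorted by the first, then by
the second coordinate, with ranks in `{1, …, k-1}` and positive weights. -/
def IsGrid (k : ℕ) (X : List (Pt ℝ)) : Prop :=
  X.Pairwise (fun a b => a.q < b.q ∨ (a.q = b.q ∧ a.r < b.r)) ∧
    ∀ x ∈ X, 1 ≤ x.r ∧ x.r < k ∧ 0 < x.w

def IsUpperIn (X U : List (Pt ℝ)) : Prop :=
  U.Sublist X ∧ ∀ x ∈ U, ∀ z ∈ X, x.pos ≤ z.pos → z ∈ U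

def IsLowerIn (X L : List (Pt ℝ)) : Prop :=
  L.Sublist X ∧ ∀ x ∈ L, ∀ z ∈ X, z.pos ≤ x.pos → z ∈ L

/-- The weighted mean. -/
noncomputable def avg (S : List (Pt ℝ)) : ℝ :=
  (S.map fun x => x.w * x.y).sum / (S.map fun x => x.w).sum

/-- `H_X(S) = ∑_{x ∈ S} w_x (y_x - Avg X)`. -/
noncomputable def excess (X S : List (Pt ℝ)) : ℝ :=
  (S.map fun x => x.w * (x.y - avg X)).sum

def IsMaximalUpperSet (X U : List (Pt ℝ)) : Prop :=
  IsUpperIn X U ∧ ∀ U', IsUpperIn X U' → excess X U' ≤ excess X U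

def IsotonicOn (S : List (Pt ℝ)) (f : ℝ × ℕ → ℝ) : Prop :=
  ∀ x ∈ S, ∀ z ∈ S, x.pos ≤ z.pos → f x.pos ≤ f z.pos

/-- Weighted least-squares isotonic regression on `S`. -/
def IsIsotonicRegression (S : List (Pt ℝ)) (f : ℝ × ℕ → ℝ) : Prop :=
  IsotonicOn S f ∧ ∀ h, IsotonicOn S h →
    (S.map fun x => x.w * (f x.pos - x.y) ^ 2).sum ≤
      (S.map fun x => x.w * (h x.pos - x.y) ^ 2).sum

/-- `X` is the disjoint union of the lower set `L` and the upper set `U`, and some number separates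
the isotonic regressions on `L` and on `U`. -/
def IsProjectionPair (X L U : List (Pt ℝ)) : Prop :=
  (L ++ U).Perm X ∧ IsLowerIn X L ∧ IsUpperIn X U ∧
    ∃ fL fU : ℝ × ℕ → ℝ, IsIsotonicRegression L fL ∧ IsIsotonicRegression U fU ∧
      ∃ d : ℝ, ∀ x ∈ L, ∀ z ∈ U, fL x.pos ≤ d ∧ d ≤ fU z.pos

end Sets

end SCIR

namespace SCIR

set_option linter.unusedSectionVars false

/-! ### Values and step counts of the primitives -/

section Timing

variable {α β : Type}

/-! Dynamic program. The processing order is a linear extension of the coordinatewise order, and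
among later points those above a new point `x` are exactly those of rank at least `x.r`. So an upper
set of the points treated so far matters only through a threshold `j`: all of them of rank at least
`j` belong to it. Taking `x` lowers the threshold to `min j x.r`; leaving it out is allowed only if
`x.r < j`. This dichotomy (`IsUpperFrom.cases_cons`) is the recurrence, and `traceT_tableT` follows
by induction.

Splitting. Let `b` be the mean of `X`, let `U` be a maximal upper set and `L` its complement.
Comparing `U` with `U ∪ V` and `U \ V` shows that upper sets `V` of `L` have nonpositive deviation
from `b` and lower sets `V` of `U` nonnegative deviation. These certificates survive further
splitting (`SplitFit.le`, `SplitFit.ge`), so the fit on `L` stays below `b` and the fit on `U` above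
it; hence the glued fit is isotonic. Recursion stops at flat blocks, where no upper set has a mean
above the block mean. By a layer-cake argument (`sum_mul_nonpos_of_superlevel`), an isotonic
function there correlates nonpositively with the residuals. A tangent inequality then makes the
block mean at least as good as any isotonic competitor, block by block, both for squared error and
for the logarithmic loss. Summing over blocks gives optimality (`SplitFit.sum_le`).

Pooling is exact because the logarithmic loss of a weighted point depends only on `w y` and `w (1 -
y)`, which add up. For the cost, a split of `n` points into `a + c` takes `O(n k)` steps, and the
cross term of `(a + c) ^ 2` pays for it, so the recursion takes `O(n ^ 2 k)`. -/

@[simp] theorem bind_val (x : Timed α) (f : α → Timed β) : (x >>= f).val = (f x.val).val := rfl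

@[simp] theorem bind_steps (x : Timed α) (f : α → Timed β) :
    (x >>= f).steps = x.steps + (f x.val).steps := rfl

@[simp] theorem pure_val (a : α) : (pure a : Timed α).val = a := rfl

@[simp] theorem pure_steps (a : α) : (pure a : Timed α).steps = 0 := rfl

@[simp] theorem tick_steps : tick.steps = 1 := rfl

@[simp] theorem succT_val (a : ℕ) : (succT a).val = a + 1 := rfl

@[simp] theorem succT_steps (a : ℕ) : (succT a).steps = 1 := rfl

@[simp] theorem predT_val (a : ℕ) : (predT a).val = a - 1 := rfl

@[simp] theorem predT_steps (a : ℕ) : (predT a).steps = 1 := rfl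

@[simp] theorem natLtT_val (a b : ℕ) : (natLtT a b).val = decide (a < b) := rfl

@[simp] theorem natLtT_steps (a b : ℕ) : (natLtT a b).steps = 1 := rfl

@[simp] theorem natLeT_val (a b : ℕ) : (natLeT a b).val = decide (a ≤ b) := rfl

@[simp] theorem natLeT_steps (a b : ℕ) : (natLeT a b).steps = 1 := rfl

@[simp] theorem natEqT_val (a b : ℕ) : (natEqT a b).val = decide (a = b) := rfl

@[simp] theorem natEqT_steps (a b : ℕ) : (natEqT a b).steps = 1 := rfl

@[simp] theorem consT_val (a : α) (l : List α) : (consT a l).val = a :: l := rfl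

@[simp] theorem consT_steps (a : α) (l : List α) : (consT a l).steps = 1 := rfl

variable {R : Type} [Field R]

@[simp] theorem addT_val (a b : R) : (addT a b).val = a + b := rfl

@[simp] theorem addT_steps (a b : R) : (addT a b).steps = 1 := rfl

@[simp] theorem subT_val (a b : R) : (subT a b).val = a - b := rfl

@[simp] theorem subT_steps (a b : R) : (subT a b).steps = 1 := rfl

@[simp] theorem mulT_val (a b : R) : (mulT a b).val = a * b := rfl

@[simp] theorem mulT_steps (a b : R) : (mulT a b).steps = 1 := rfl

@[simp] theorem divT_val (a b : R) : (divT a b).val = a / b := rfl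

@[simp] theorem divT_steps (a b : R) : (divT a b).steps = 1 := rfl

variable [LinearOrder R]

@[simp] theorem ltT_val (a b : R) : (ltT a b).val = decide (a < b) := rfl

@[simp] theorem ltT_steps (a b : R) : (ltT a b).steps = 1 := rfl

end Timing

/-! ### List routines and insertion sort -/

section Lists

variable {α : Type}

@[simp] theorem appendT_val (l l' : List α) : (appendT l l').val = l ++ l' := by
  induction l with
  | nil => simp [appendT]
  | cons a l ih => simp [appendT, ih]

@[simp] theorem appendT_steps (l l' : List α) : (appendT l l').steps = 2 * l.length + 1 := by
  induction l with
  | nil => simp [appendT]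
  | cons a l ih => simp [appendT, ih]; ring

theorem insertT_perm (before : α → α → Timed Bool) (a : α) (l : List α) :
    (insertT before a l).val.Perm (a :: l) := by
  induction l with
  | nil => simp [insertT]
  | cons b l ih =>
    simp only [insertT, bind_val]
    split
    · simp
    · simpa using (ih.cons b).trans (List.Perm.swap a b l)

theorem sortT_perm (before : α → α → Timed Bool) (l : List α) :
    (sortT before l).val.Perm l := by
  induction l with
  | nil => simp [sortT]
  | cons a l ih =>
    simp only [sortT, bind_val]
    exact (insertT_perm before a _).trans (ih.cons a)

/-- Insertion sort sorts for a transitive relation `r` that holds between `a` and `b` if `a` is to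
be placed in front of `b`, and between `b` and `a` otherwise. -/
theorem sortT_pairwise (before : α → α → Timed Bool) (r : α → α → Prop)
    (hr : ∀ a b c, r a b → r b c → r a c) (l : List α)
    (h₁ : ∀ a ∈ l, ∀ b ∈ l, (before a b).val = true → r a b)
    (h₂ : l.Pairwise fun a b => (before a b).val = false → r b a) :
    (sortT before l).val.Pairwise r := by
  have hins (a : α) (s : List α) (hs : s.Pairwise r)
      (h : ∀ b ∈ s, ((before a b).val = true → r a b) ∧ ((before a b).val = false → r b a)) :
      (insertT before a s).val.Pairwise r := by
    induction s with
    | nil => simp [insertT]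
    | cons b s ih =>
      rw [List.pairwise_cons] at hs
      simp only [insertT, bind_val]
      split
      next hb =>
        have hab := (h b (by simp)).1 hb
        simp only [consT_val, List.pairwise_cons, List.mem_cons, forall_eq_or_imp]
        exact ⟨⟨hab, fun c hc => hr _ _ _ hab (hs.1 c hc)⟩, hs⟩
      next hb =>
        simp only [bind_val, consT_val, List.pairwise_cons]
        refine ⟨fun c hc => ?_, ih hs.2 fun c hc => h c (by simp [hc])⟩
        rcases List.mem_cons.1 ((insertT_perm before a s).mem_iff.1 hc) with rfl | hc
        · exact (h b (by simp)).2 (by simpa using hb)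
        · exact hs.1 c hc
  induction l with
  | nil => simp [sortT]
  | cons a l ih =>
    rw [List.pairwise_cons] at h₂
    simp only [sortT, bind_val]
    refine hins a _ (ih (fun b hb c hc => h₁ b (by simp [hb]) c (by simp [hc])) h₂.2) ?_
    intro b hb
    have hb' := (sortT_perm before l).mem_iff.1 hb
    exact ⟨h₁ a (by simp) b (by simp [hb']), h₂.1 b hb'⟩

/-- Passing an entry during insertion costs 6: the call, at most 4 for the comparison, and a new
cell. The terms `6 s + 3` for `s < n` add up to exactly `3 n ^ 2`. -/
theorem sortT_steps_le (before : α → α → Timed Bool) (hb : ∀ a b, (before a b).steps ≤ 4)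
    (l : List α) : (sortT before l).steps ≤ 3 * l.length ^ 2 + 1 := by
  have hins (a : α) (s : List α) : (insertT before a s).steps ≤ 6 * s.length + 2 := by
    induction s with
    | nil => simp [insertT]
    | cons b s ih =>
      have := hb a b
      simp only [insertT, bind_steps, tick_steps, List.length_cons]
      split
      · simp only [consT_steps]; lia
      · simp only [bind_steps, consT_steps]; lia
  induction l with
  | nil => simp [sortT]
  | cons a l ih =>
    have h := hins a (sortT before l).val
    rw [(sortT_perm before l).length_eq] at h
    simp only [sortT, bind_steps, tick_steps, List.length_cons]
    nlinarith

-- Entries are counted from 1, and index 0 also reads the head, in agreement with truncated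
-- subtraction.
@[simp] theorem nthT_val (d : α) (l : List α) (n : ℕ) : (nthT d l n).val = l.getD (n - 1) d := by
  induction l generalizing n with
  | nil => simp [nthT]
  | cons a l ih =>
    simp only [nthT, bind_val, natLeT_val, decide_eq_true_eq]
    split
    next h => simp [Nat.sub_eq_zero_of_le h]
    next h =>
      obtain ⟨n, rfl⟩ : ∃ t, n = t + 2 := ⟨n - 2, by lia⟩
      simp [ih]

theorem nthT_steps_le (d : α) (l : List α) (n : ℕ) : (nthT d l n).steps ≤ 3 * l.length + 1 := by
  induction l generalizing n with
  | nil => simp [nthT]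
  | cons a l ih =>
    have := ih (n - 1)
    simp only [nthT, bind_steps, tick_steps, natLeT_steps, List.length_cons]
    split
    · simp only [pure_steps]; lia
    · simp only [bind_steps, predT_steps, predT_val]; lia

@[simp] theorem replicateT_val (a : α) (n : ℕ) : (replicateT a n).val = List.replicate n a := by
  induction n with
  | zero => simp [replicateT]
  | succ n ih => simp [replicateT, ih, List.replicate_succ]

@[simp] theorem replicateT_steps (a : α) (n : ℕ) : (replicateT a n).steps = 2 * n + 1 := by
  induction n with
  | zero => simp [replicateT]
  | succ n ih => simp [replicateT, ih]; ring

end Lists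

/-! ### Sizes and step counts of the stages of the algorithm -/

section Steps

variable {R : Type} [Field R] [LinearOrder R]

theorem classBeforeT_steps_le (a b : ClassEntry R) : (classBeforeT a b).steps ≤ 4 := by
  simp only [classBeforeT, bind_steps, tick_steps, ltT_steps]
  split
  · simp
  · simp only [bind_steps, ltT_steps]
    split <;> simp

theorem ptBeforeT_steps_le (a b : Pt R) : (ptBeforeT a b).steps ≤ 4 := by
  simp only [ptBeforeT, bind_steps, tick_steps, ltT_steps]
  split
  · simp
  · simp only [bind_steps, ltT_steps]
    split <;> simp

theorem samePosT_steps_le (a b : Pt R) : (samePosT a b).steps ≤ 4 := by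
  simp only [samePosT, bind_steps, tick_steps, ltT_steps]
  split
  · simp
  · simp only [bind_steps, ltT_steps]
    split <;> simp

theorem cumulateT_length (r : ℕ) (q y : R) (l : List (ClassEntry R)) :
    (cumulateT r q y l).val.length = l.length - 1 := by
  induction l generalizing r q y with
  | nil => simp [cumulateT]
  | cons e l ih =>
    cases l with
    | nil => simp [cumulateT]
    | cons e' l => simp [cumulateT, ih]

theorem cumulateT_steps_le (r : ℕ) (q y : R) (l : List (ClassEntry R)) :
    (cumulateT r q y l).steps ≤ 5 * l.length + 1 := by
  induction l generalizing r q y with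
  | nil => simp [cumulateT]
  | cons e l ih =>
    cases l with
    | nil => simp [cumulateT]
    | cons e' l =>
      have := ih (r + 1) (q + e.score) (y + e.label)
      simp [cumulateT] at this ⊢
      lia

theorem collectT_length (k : ℕ) (V : List (List (ClassEntry R))) (hV : ∀ s ∈ V, s.length = k) :
    (collectT V).val.length = V.length * (k - 1) := by
  induction V with
  | nil => simp [collectT]
  | cons s V ih =>
    simp only [List.mem_cons, forall_eq_or_imp] at hV
    simp [collectT, cumulateT_length, (sortT_perm classBeforeT s).length_eq, hV.1, ih hV.2]
    ring

theorem collectT_steps_le (k : ℕ) (V : List (List (ClassEntry R))) (hV : ∀ s ∈ V, s.length = k) :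
    (collectT V).steps ≤ V.length * (3 * k ^ 2 + 7 * k + 4) + 1 := by
  induction V with
  | nil => simp [collectT]
  | cons s V ih =>
    simp only [List.mem_cons, forall_eq_or_imp] at hV
    have h₁ := sortT_steps_le classBeforeT classBeforeT_steps_le s
    have h₂ := cumulateT_steps_le 0 0 0 (sortT classBeforeT s).val
    have h₃ := ih hV.2
    rw [(sortT_perm classBeforeT s).length_eq] at h₂
    rw [hV.1] at h₁ h₂
    simp only [collectT, bind_steps, tick_steps, appendT_steps, cumulateT_length,
      (sortT_perm classBeforeT s).length_eq, hV.1, List.length_cons]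
    rw [Nat.succ_mul]
    lia

theorem mergeT_length_le (X : List (Pt R)) : (mergeT X).val.length ≤ X.length := by
  induction X with
  | nil => simp [mergeT]
  | cons x X ih =>
    simp only [mergeT, bind_val, List.length_cons]
    split
    · simp
    next z zs h =>
      rw [h, List.length_cons] at ih
      simp only [bind_val]
      split
      · simp; lia
      · simp; lia

theorem mergeT_steps_le (X : List (Pt R)) : (mergeT X).steps ≤ 12 * X.length + 1 := by
  induction X with
  | nil => simp [mergeT]
  | cons x X ih =>
    simp only [mergeT, bind_steps, tick_steps, List.length_cons]
    split
    · simp; lia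
    next z zs h =>
      have := samePosT_steps_le x z
      simp only [bind_steps]
      split
      · simp [poolT]; lia
      · simp; lia

theorem aggregateT_length_le (k : ℕ) (V : List (List (ClassEntry R)))
    (hV : ∀ s ∈ V, s.length = k) : (aggregateT V).val.length ≤ V.length * (k - 1) := by
  simp only [aggregateT, bind_val]
  refine (mergeT_length_le _).trans ?_
  rw [(sortT_perm _ _).length_eq, collectT_length k V hV]

theorem aggregateT_steps_le (k : ℕ) (V : List (List (ClassEntry R)))
    (hV : ∀ s ∈ V, s.length = k) (hk : 0 < k) (hV₀ : V ≠ []) :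
    (aggregateT V).steps ≤ 33 * (V.length ^ 2 * k ^ 2) := by
  have h₁ := collectT_steps_le k V hV
  have h₂ := sortT_steps_le ptBeforeT ptBeforeT_steps_le (collectT V).val
  have h₃ := mergeT_steps_le (sortT ptBeforeT (collectT V).val).val
  rw [(sortT_perm _ _).length_eq] at h₃
  have hN : (collectT V).val.length ≤ V.length * k := by
    rw [collectT_length k V hV]
    gcongr
    lia
  have hm : 0 < V.length := List.length_pos_iff.2 hV₀
  simp only [aggregateT, bind_steps, tick_steps]
  generalize (collectT V).val.length = N at *
  generalize V.length = m at *
  have h₄ : m * k ≤ m ^ 2 * k ^ 2 := by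
    rw [← mul_pow]
    exact Nat.le_self_pow (by simp) _
  have h₅ : N ^ 2 ≤ m ^ 2 * k ^ 2 := by
    rw [← mul_pow]
    gcongr
  have h₆ : m * k ^ 2 ≤ m ^ 2 * k ^ 2 := by
    gcongr
    exact Nat.le_self_pow (by simp) _
  have h₇ : m ≤ m * k := Nat.le_mul_of_pos_right _ hk
  -- With `B = m ^ 2 * k ^ 2 ≥ 1`, collecting costs at most `14 B + 1`, sorting `3 B + 1`, merging
  -- `12 B + 1` and the call 1, in total at most `33 B`.
  nlinarith

@[simp] theorem sumsT_val (X : List (Pt R)) :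
    (sumsT X).val = ((X.map fun x => x.w * x.y).sum, (X.map fun x => x.w).sum) := by
  induction X with
  | nil => simp [sumsT]
  | cons x X ih => simp [sumsT, ih]

theorem sumsT_steps (X : List (Pt R)) : (sumsT X).steps = 4 * X.length + 1 := by
  induction X with
  | nil => simp [sumsT]
  | cons x X ih => simp [sumsT, ih]; ring

@[simp] theorem avgT_val (X : List (Pt ℝ)) : (avgT X).val = avg X := by simp [avgT, avg]

theorem avgT_steps (X : List (Pt R)) : (avgT X).steps = 4 * X.length + 3 := by
  simp [avgT, sumsT_steps]; ring

theorem rowT_steps_le (l : ℕ) (v inc : R) (j : ℕ) (ms : List R) :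
    (rowT l v inc j ms).steps ≤ 6 * ms.length + 1 := by
  induction ms generalizing j with
  | nil => simp [rowT]
  | cons a ms ih =>
    have := ih (j + 1)
    simp only [rowT, bind_steps, tick_steps, succT_steps, succT_val, natLeT_steps, List.length_cons]
    split
    · simp; lia
    · simp only [bind_steps, ltT_steps]
      split
      · simp; lia
      · simp; lia

@[simp] theorem rowT_length_fst (l : ℕ) (v inc : R) (j : ℕ) (ms : List R) :
    (rowT l v inc j ms).val.1.length = ms.length := by
  induction ms generalizing j with
  | nil => simp [rowT]
  | cons a ms ih =>
    have := ih (j + 1)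
    simp only [rowT, bind_val]
    split
    · simpa using this
    · simp only [bind_val]
      split <;> simpa using this

@[simp] theorem rowT_length_snd (l : ℕ) (v inc : R) (j : ℕ) (ms : List R) :
    (rowT l v inc j ms).val.2.length = ms.length := by
  induction ms generalizing j with
  | nil => simp [rowT]
  | cons a ms ih =>
    have := ih (j + 1)
    simp only [rowT, bind_val]
    split
    · simpa using this
    · simp only [bind_val]
      split <;> simpa using this

/-- The entries of a row of the two tables; `j` is the index of the first column. -/
theorem rowT_getD (l : ℕ) (v inc : R) (j : ℕ) (ms : List R) (i : ℕ) (hi : i < ms.length) :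
    (rowT l v inc j ms).val.1.getD i 0 =
        (if j + i ≤ l then ms.getD i 0 + v else if inc < ms.getD i 0 then ms.getD i 0 else inc) ∧
      (rowT l v inc j ms).val.2.getD i 0 =
        (if j + i ≤ l then j + i else if inc < ms.getD i 0 then j + i else l) := by
  induction ms generalizing j i with
  | nil => simp at hi
  | cons a ms ih =>
    simp only [rowT, bind_val, succT_val, natLeT_val, decide_eq_true_eq]
    cases i with
    | zero =>
      by_cases h : j ≤ l
      · simp [h]
      · by_cases h' : inc < a <;> simp [h, h']
    | succ i =>
      have := ih (j + 1) i (by simpa using hi)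
      rw [add_assoc, add_comm 1 i] at this
      by_cases h : j ≤ l
      · simpa [h] using this
      · by_cases h' : inc < a <;> simpa [h, h'] using this

@[simp] theorem tableT_length_fst (b : R) (c : ℕ) (X : List (Pt R)) :
    (tableT b c X).val.1.length = c := by
  induction X with
  | nil => simp [tableT]
  | cons x X ih => simp [tableT, ih]

theorem tableT_length_of_mem_snd (b : R) (c : ℕ) (X : List (Pt R)) :
    ∀ s ∈ (tableT b c X).val.2, s.length = c := by
  induction X with
  | nil => simp [tableT]
  | cons x X ih => simpa [tableT] using ih

/-- Per point: `3 c + 1` for walking along the row to `M[i+1, l]`, `6 c + 1` for the new row, and 5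
further steps. Linear-time list access therefore does not change the order of the cost. -/
theorem tableT_steps_le (b : R) (c : ℕ) (X : List (Pt R)) :
    (tableT b c X).steps ≤ X.length * (9 * c + 7) + 2 * c + 2 := by
  induction X with
  | nil => simp [tableT]; lia
  | cons x X ih =>
    have h₁ := nthT_steps_le 0 (tableT b c X).val.1 x.r
    have h₂ := rowT_steps_le x.r (x.w * (x.y - b))
      ((nthT 0 (tableT b c X).val.1 x.r).val + x.w * (x.y - b)) 1 (tableT b c X).val.1
    rw [tableT_length_fst] at h₁ h₂
    simp only [tableT, bind_steps, tick_steps, subT_steps, subT_val, mulT_steps, mulT_val,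
      addT_steps, addT_val, consT_steps, pure_steps, List.length_cons, Nat.succ_mul]
    lia

theorem traceT_steps_le (c j : ℕ) (X : List (Pt R)) (T : List (List ℕ))
    (hT : ∀ s ∈ T, s.length = c) : (traceT j X T).steps ≤ X.length * (3 * c + 4) + 1 := by
  induction X generalizing j T with
  | nil => simp [traceT]
  | cons x X ih =>
    cases T with
    | nil => simp [traceT]
    | cons s T =>
      simp only [List.mem_cons, forall_eq_or_imp] at hT
      have h₁ := nthT_steps_le 0 s j
      rw [hT.1] at h₁
      have h₂ := ih (nthT 0 s j).val T hT.2
      simp only [traceT, bind_steps, tick_steps, natLeT_steps, List.length_cons, Nat.succ_mul]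
      split
      · simp only [bind_steps, consT_steps, pure_steps]; lia
      · simp only [bind_steps, consT_steps, pure_steps]; lia

theorem maxUpperSetT_steps_le (c : ℕ) (hc : 0 < c) (X : List (Pt R)) (hX : X ≠ []) :
    (maxUpperSetT c X).steps ≤ 40 * (X.length * c) := by
  have h₁ := tableT_steps_le (avgT X).val c X
  have h₂ := traceT_steps_le c c X _ (tableT_length_of_mem_snd (avgT X).val c X)
  have hn : 0 < X.length := List.length_pos_iff.2 hX
  have h₃ : X.length ≤ X.length * c := Nat.le_mul_of_pos_right _ hc
  have h₄ : c ≤ X.length * c := Nat.le_mul_of_pos_left _ hn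
  simp only [maxUpperSetT, bind_steps, tick_steps, avgT_steps]
  -- The total is `12 n c + 15 n + 2 c + 7`, which is at most `36 n c` for `n, c ≥ 1`.
  nlinarith

theorem constantT_val (b : R) (X : List (Pt R)) :
    (constantT b X).val = X.map fun x => ((x.q, x.r), b) := by
  induction X with
  | nil => simp [constantT]
  | cons x X ih => simp [constantT, ih]

theorem constantT_steps (b : R) (X : List (Pt R)) :
    (constantT b X).steps = 2 * X.length + 1 := by
  induction X with
  | nil => simp [constantT]
  | cons x X ih => simp [constantT, ih]; ring

end Steps

/-! ### Correctness of the dynamic program -/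

section DynamicProgram

/-- The order in which the data points are processed. -/
def Pt.LexLt (a b : Pt ℝ) : Prop := a.q < b.q ∨ (a.q = b.q ∧ a.r < b.r)

/-- A later point is never below an earlier one, so the points already treated cannot force a new
one into an upper set. -/
theorem Pt.LexLt.not_pos_le {a b : Pt ℝ} (h : a.LexLt b) : ¬ b.pos ≤ a.pos := by
  rintro ⟨h₁, h₂⟩
  simp only [Pt.pos] at h₁ h₂
  rcases h with h | ⟨_, h⟩
  · exact h₁.not_gt h
  · exact h₂.not_gt h

/-- For later points, lying above the new one is a matter of rank alone; this is why one column
index suffices as state. -/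
theorem Pt.LexLt.pos_le {a b : Pt ℝ} (h : a.LexLt b) (hr : a.r ≤ b.r) : a.pos ≤ b.pos :=
  ⟨h.elim le_of_lt fun h => h.1.le, hr⟩

/-- Upper sets of `X` containing all points of rank at least `j`. -/
def IsUpperFrom (j : ℕ) (X U : List (Pt ℝ)) : Prop :=
  IsUpperIn X U ∧ ∀ z ∈ X, j ≤ z.r → z ∈ U

theorem IsUpperFrom.cons {x : Pt ℝ} {X U : List (Pt ℝ)} {i j : ℕ} (hx : ∀ z ∈ X, x.LexLt z)
    (hj : i ≤ j) (hr : i ≤ x.r) (h : IsUpperFrom i X U) : IsUpperFrom j (x :: X) (x :: U) := by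
  refine ⟨⟨h.1.1.cons_cons x, ?_⟩, ?_⟩
  · intro a ha z hz haz
    rcases List.mem_cons.1 hz with rfl | hz'
    · simp
    rcases List.mem_cons.1 ha with rfl | ha
    · exact List.mem_cons_of_mem _ (h.2 z hz' (hr.trans haz.2))
    · exact List.mem_cons_of_mem _ (h.1.2 a ha z hz' haz)
  · intro z hz hzj
    rcases List.mem_cons.1 hz with rfl | hz
    · simp
    · exact List.mem_cons_of_mem _ (h.2 z hz (hj.trans hzj))

theorem IsUpperFrom.cons_left {x : Pt ℝ} {X U : List (Pt ℝ)} {j : ℕ} (hx : ∀ z ∈ X, x.LexLt z)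
    (hr : x.r < j) (h : IsUpperFrom j X U) : IsUpperFrom j (x :: X) U := by
  refine ⟨⟨h.1.1.cons x, ?_⟩, ?_⟩
  · intro a ha z hz haz
    rcases List.mem_cons.1 hz with rfl | hz
    · exact absurd haz (hx a (h.1.1.subset ha)).not_pos_le
    · exact h.1.2 a ha z hz haz
  · intro z hz hzj
    rcases List.mem_cons.1 hz with rfl | hz
    · lia
    · exact h.2 z hz hzj

/-- This gives the upper bound in the recurrence. If `x` is taken, all later points of rank at least
`x.r` lie above it and must be taken too, so the threshold drops to the minimum. -/
theorem IsUpperFrom.cases_cons {x : Pt ℝ} {X U : List (Pt ℝ)} {j : ℕ}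
    (hx : ∀ z ∈ X, x.LexLt z) (h : IsUpperFrom j (x :: X) U) :
    (∃ V, U = x :: V ∧ IsUpperFrom (min j x.r) X V) ∨ (x.r < j ∧ IsUpperFrom j X U) := by
  have hne : ∀ z ∈ X, z ≠ x := fun z hz hzx => (hx z hz).not_pos_le (by rw [hzx])
  obtain ⟨⟨hs, hup⟩, hj⟩ := h
  rcases List.sublist_cons_iff.1 hs with hs | ⟨V, rfl, hsV⟩
  · right
    refine ⟨?_, ⟨hs, fun a ha z hz => hup a ha z (by simp [hz])⟩, fun z hz => hj z (by simp [hz])⟩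
    by_contra hr
    exact hne x (hs.subset (hj x (by simp) (not_lt.1 hr))) rfl
  · left
    have key : ∀ z ∈ X, z ∈ x :: V → z ∈ V := fun z hz hzV =>
      (List.mem_cons.1 hzV).resolve_left (hne z hz)
    refine ⟨V, rfl, ⟨hsV, fun a ha z hz haz => ?_⟩, fun z hz hzr => ?_⟩
    · exact key z hz (hup a (by simp [ha]) z (by simp [hz]) haz)
    · rcases min_le_iff.1 hzr with hzr | hzr
      · exact key z hz (hj z (by simp [hz]) hzr)
      · exact key z hz (hup x (by simp) z (by simp [hz]) ((hx z hz).pos_le hzr))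

/-- Tracing the table back from column `j` yields a best upper set among those that contain all
points of rank at least `j`; its score is the table entry. -/
theorem traceT_tableT (b : ℝ) (c : ℕ) (X : List (Pt ℝ)) (hX : X.Pairwise Pt.LexLt)
    (hr : ∀ x ∈ X, 1 ≤ x.r ∧ x.r ≤ c) (j : ℕ) (hj : 1 ≤ j) (hjc : j ≤ c) (L U : List (Pt ℝ))
    (h : (traceT j X (tableT b c X).val.2).val = (L, U)) :
    (L ++ U).Perm X ∧ L.Sublist X ∧ IsUpperFrom j X U ∧
      (U.map fun x => x.w * (x.y - b)).sum = (tableT b c X).val.1.getD (j - 1) 0 ∧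
      ∀ U', IsUpperFrom j X U' →
        (U'.map fun x => x.w * (x.y - b)).sum ≤ (tableT b c X).val.1.getD (j - 1) 0 := by
  induction X generalizing j L U with
  | nil =>
    simp only [traceT, bind_val, pure_val, Prod.mk.injEq] at h
    obtain ⟨rfl, rfl⟩ := h
    have hz : (List.replicate c (0 : ℝ)).getD (j - 1) 0 = 0 := by
      rw [List.getD_eq_getElem?_getD, List.getElem?_replicate]
      split <;> rfl
    simp only [tableT, bind_val, replicateT_val, pure_val, hz]
    refine ⟨by simp, by simp, ⟨⟨by simp, by simp⟩, by simp⟩, by simp, ?_⟩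
    rintro U' ⟨⟨hU', -⟩, -⟩
    rw [List.sublist_nil.1 hU']
    simp
  | cons x X ih =>
    rw [List.pairwise_cons] at hX
    obtain ⟨hx, hX⟩ := hX
    obtain ⟨hxr, hr⟩ := List.forall_mem_cons.1 hr
    specialize ih hX hr
    set T := (tableT b c X).val with hT
    have hlen : T.1.length = c := tableT_length_fst b c X
    set v := x.w * (x.y - b) with hv
    set inc := T.1.getD (x.r - 1) 0 + v with hinc
    have hrow := rowT_getD x.r v inc 1 T.1 (j - 1) (by lia)
    rw [show 1 + (j - 1) = j by lia] at hrow
    set u := (rowT x.r v inc 1 T.1).val with hu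
    have htab : (tableT b c (x :: X)).val = (u.1, u.2 :: T.2) := by
      simp only [tableT, bind_val, pure_val, consT_val, addT_val, nthT_val, subT_val, mulT_val,
        hu, hinc, hv, hT]
    rw [htab] at h ⊢
    simp only [traceT, bind_val, nthT_val, natLeT_val, decide_eq_true_eq] at h
    simp only [hrow.1]
    -- The recorded column also encodes the decision: it is at most `x.r` exactly when `x` is taken.
    rw [hrow.2] at h
    -- Common to both ways of taking `x`: forced, with `i = j ≤ x.r`, or by choice, with `i = x.r <
    -- j`.
    have take (i : ℕ) (hi : 1 ≤ i) (hij : i ≤ j) (hix : i ≤ x.r)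
        (hle : ∀ U', IsUpperFrom j (x :: X) U' →
          (U'.map fun x => x.w * (x.y - b)).sum ≤ T.1.getD (i - 1) 0 + v)
        (h : ((traceT i X T.2).val.1, x :: (traceT i X T.2).val.2) = (L, U)) :
        (L ++ U).Perm (x :: X) ∧ L.Sublist (x :: X) ∧ IsUpperFrom j (x :: X) U ∧
          (U.map fun x => x.w * (x.y - b)).sum = T.1.getD (i - 1) 0 + v ∧
          ∀ U', IsUpperFrom j (x :: X) U' →
            (U'.map fun x => x.w * (x.y - b)).sum ≤ T.1.getD (i - 1) 0 + v := by
      obtain ⟨h₁, h₂, h₃, h₄, -⟩ := ih i hi (hij.trans hjc) _ _ rfl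
      obtain ⟨rfl, rfl⟩ := Prod.mk.inj h
      refine ⟨?_, h₂.cons x, h₃.cons hx hij hix, ?_, hle⟩
      · exact List.perm_middle.trans (h₁.cons x)
      · rw [List.map_cons, List.sum_cons, h₄, add_comm]
    have best (i : ℕ) (hi : 1 ≤ i) (hic : i ≤ c) (U' : List (Pt ℝ)) (hU' : IsUpperFrom i X U') :
        (U'.map fun x => x.w * (x.y - b)).sum ≤ T.1.getD (i - 1) 0 :=
      (ih i hi hic _ _ rfl).2.2.2.2 U' hU'
    have bound (U' : List (Pt ℝ)) (hU' : IsUpperFrom j (x :: X) U') :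
        (U'.map fun x => x.w * (x.y - b)).sum ≤ T.1.getD (min j x.r - 1) 0 + v ∨
          (x.r < j ∧ (U'.map fun x => x.w * (x.y - b)).sum ≤ T.1.getD (j - 1) 0) := by
      rcases hU'.cases_cons hx with ⟨V, rfl, hV⟩ | ⟨hlt, hV⟩
      · left
        have := best _ (le_min hj hxr.1) (min_le_of_left_le hjc) V hV
        rw [List.map_cons, List.sum_cons]
        linarith
      · exact Or.inr ⟨hlt, best j hj hjc U' hV⟩
    by_cases hjx : j ≤ x.r
    · simp only [hjx, if_true, bind_val, pure_val, consT_val] at h ⊢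
      refine take j hj le_rfl hjx (fun U' hU' => ?_) h
      have := bound U' hU'
      rw [min_eq_left hjx] at this
      exact this.resolve_right fun h => absurd h.1 (not_lt.2 hjx)
    · have hmin : min j x.r = x.r := min_eq_right (not_le.1 hjx).le
      rw [hmin] at bound
      by_cases hlt : inc < T.1.getD (j - 1) 0
      · simp only [hjx, hlt, if_true, if_false, bind_val, pure_val, consT_val] at h ⊢
        obtain ⟨h₁, h₂, h₃, h₄, -⟩ := ih j hj hjc _ _ rfl
        obtain ⟨rfl, rfl⟩ := Prod.mk.inj h
        refine ⟨h₁.cons x, h₂.cons_cons x, h₃.cons_left hx (not_le.1 hjx), h₄, fun U' hU' => ?_⟩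
        rcases bound U' hU' with h | h
        · exact h.trans hlt.le
        · exact h.2
      -- Ties are resolved in favour of taking `x`.
      · simp only [hjx, hlt, le_refl, if_true, if_false, bind_val, pure_val, consT_val] at h ⊢
        refine take x.r hxr.1 (not_le.1 hjx).le le_rfl (fun U' hU' => ?_) h
        rcases bound U' hU' with h | h
        · exact h
        · exact h.2.trans (not_lt.1 hlt)

theorem IsGrid.sublist {k : ℕ} {X Z : List (Pt ℝ)} (hX : IsGrid k X) (h : Z.Sublist X) :
    IsGrid k Z :=
  ⟨hX.1.sublist h, fun x hx => hX.2 x (h.subset hx)⟩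

theorem IsGrid.nodup_map_pos {k : ℕ} {X : List (Pt ℝ)} (hX : IsGrid k X) :
    (X.map Pt.pos).Nodup := by
  rw [List.Nodup, List.pairwise_map]
  refine List.Pairwise.imp (fun {a b} h => ?_) hX.1
  exact fun hab => Pt.LexLt.not_pos_le h hab.ge

theorem IsGrid.nodup {k : ℕ} {X : List (Pt ℝ)} (hX : IsGrid k X) : X.Nodup :=
  hX.nodup_map_pos.of_map

theorem IsGrid.eq_of_pos_eq {k : ℕ} {X : List (Pt ℝ)} (hX : IsGrid k X) {x z : Pt ℝ} (hx : x ∈ X)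
    (hz : z ∈ X) (h : x.pos = z.pos) : x = z :=
  List.inj_on_of_nodup_map hX.nodup_map_pos hx hz h

theorem maxUpperSetT_spec {k : ℕ} {X : List (Pt ℝ)} (hX : IsGrid k X) (hX₀ : X ≠ [])
    {L U : List (Pt ℝ)} (h : (maxUpperSetT k X).val = (L, U)) :
    (L ++ U).Perm X ∧ L.Sublist X ∧ IsMaximalUpperSet X U := by
  simp only [maxUpperSetT, bind_val, avgT_val] at h
  have hk : 1 ≤ k := by
    obtain ⟨x, hx⟩ := List.exists_mem_of_ne_nil X hX₀
    have := hX.2 x hx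
    lia
  obtain ⟨h₁, h₂, h₃, h₄, h₅⟩ := traceT_tableT (avg X) k X hX.1
    (fun x hx => ⟨(hX.2 x hx).1, (hX.2 x hx).2.1.le⟩) k hk le_rfl L U h
  refine ⟨h₁, h₂, h₃.1, fun U' hU' => ?_⟩
  rw [excess, excess, h₄]
  -- Column `k` imposes no constraint, because all ranks are below `k`.
  refine h₅ U' ⟨hU', fun z hz hzk => ?_⟩
  have := (hX.2 z hz).2.1
  lia

end DynamicProgram

/-! ### Optimality of recursive splitting -/

section Blocks

open scoped Classical

/-- A sum against an isotonic weight is a mixture of the sums over superlevel sets. -/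
theorem sum_mul_nonpos_of_superlevel {ι : Type*} (S : Finset ι) (v h : ι → ℝ)
    (h₀ : ∑ x ∈ S, v x = 0) (hle : ∀ t, ∑ x ∈ S with t ≤ h x, v x ≤ 0) :
    ∑ x ∈ S, v x * h x ≤ 0 := by
  -- Induction on the number of values of `h`: lowering the top value `M` to the next value `M'`
  -- removes one value, and the sum changes by `M - M'` times the sum of `v` over the top level set.
  induction hn : (S.image h).card using Nat.strong_induction_on generalizing h with
  | _ n ih =>
    subst hn
    rcases S.eq_empty_or_nonempty with rfl | hS
    · simp
    have hI : (S.image h).Nonempty := hS.image h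
    set M := (S.image h).max' hI with hM
    have hMmem : M ∈ S.image h := Finset.max'_mem _ _
    have hleM : ∀ x ∈ S, h x ≤ M := fun x hx => Finset.le_max' _ _ (Finset.mem_image_of_mem h hx)
    by_cases hE : ((S.image h).erase M).Nonempty
    · set M' := ((S.image h).erase M).max' hE with hM'
      have hM'mem : M' ∈ (S.image h).erase M := Finset.max'_mem _ _
      have hM'lt : M' < M :=
        lt_of_le_of_ne (Finset.le_max' _ _ (Finset.mem_of_mem_erase hM'mem))
          (Finset.ne_of_mem_erase hM'mem)
      have hor : ∀ x ∈ S, h x = M ∨ h x ≤ M' := fun x hx => by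
        by_cases hx' : h x = M
        · exact Or.inl hx'
        · exact Or.inr (Finset.le_max' _ _
            (Finset.mem_erase.2 ⟨hx', Finset.mem_image_of_mem h hx⟩))
      have hsub : S.image (fun x => min (h x) M') ⊆ (S.image h).erase M := by
        intro a ha
        obtain ⟨x, hx, rfl⟩ := Finset.mem_image.1 ha
        rcases hor x hx with h' | h'
        · simpa [h', hM'lt.le] using hM'mem
        · rw [min_eq_left h']
          exact Finset.mem_erase.2 ⟨(h'.trans_lt hM'lt).ne, Finset.mem_image_of_mem h hx⟩
      have hcard : (S.image fun x => min (h x) M').card < (S.image h).card :=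
        (Finset.card_le_card hsub).trans_lt (Finset.card_erase_lt_of_mem hMmem)
      -- Truncation at `M'` keeps the superlevel sets for `t ≤ M'` and empties those above.
      have key := ih _ hcard (fun x => min (h x) M') (fun t => by
        by_cases ht : t ≤ M'
        · simpa [ht] using hle t
        · simp [ht]) rfl
      have hdecomp : ∑ x ∈ S, v x * h x =
          ∑ x ∈ S, v x * min (h x) M' + (M - M') * ∑ x ∈ S with M ≤ h x, v x := by
        rw [Finset.mul_sum, Finset.sum_filter, ← Finset.sum_add_distrib]
        refine Finset.sum_congr rfl fun x hx => ?_
        rcases hor x hx with h' | h'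
        · simp [h', hM'lt.le]
          ring
        · simp [h', (h'.trans_lt hM'lt)]
      rw [hdecomp]
      have := mul_nonpos_of_nonneg_of_nonpos (sub_pos.2 hM'lt).le (hle M)
      linarith
    · have hconst : ∀ x ∈ S, h x = M := fun x hx => by
        by_contra hx'
        exact hE ⟨h x, Finset.mem_erase.2 ⟨hx', Finset.mem_image_of_mem h hx⟩⟩
      rw [Finset.sum_congr rfl fun x hx => by rw [hconst x hx], ← Finset.sum_mul, h₀, zero_mul]

/-- The total weighted deviation of the values on `S` from the level `b`. -/
noncomputable def deviation (b : ℝ) (S : Finset (Pt ℝ)) : ℝ := ∑ x ∈ S, x.w * (x.y - b)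

theorem deviation_union (b : ℝ) {S T : Finset (Pt ℝ)} (h : Disjoint S T) :
    deviation b (S ∪ T) = deviation b S + deviation b T :=
  Finset.sum_union h

theorem deviation_sub (b c : ℝ) (S : Finset (Pt ℝ)) :
    deviation b S - deviation c S = (c - b) * ∑ x ∈ S, x.w := by
  simp only [deviation, ← Finset.sum_sub_distrib, Finset.mul_sum]
  exact Finset.sum_congr rfl fun x _ => by ring

/-- The level with zero deviation lies below every level with nonpositive deviation. -/
theorem le_of_deviation_nonpos {b c : ℝ} {S : Finset (Pt ℝ)} (hS : S.Nonempty)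
    (hw : ∀ x ∈ S, 0 < x.w) (hb : deviation b S = 0) (hc : deviation c S ≤ 0) : b ≤ c := by
  have h := deviation_sub b c S
  have hpos : 0 < ∑ x ∈ S, x.w := Finset.sum_pos hw hS
  by_contra hlt
  have := mul_neg_of_neg_of_pos (sub_neg.2 (not_le.1 hlt)) hpos
  linarith

theorem ge_of_deviation_nonneg {b c : ℝ} {S : Finset (Pt ℝ)} (hS : S.Nonempty)
    (hw : ∀ x ∈ S, 0 < x.w) (hb : deviation b S = 0) (hc : 0 ≤ deviation c S) : c ≤ b := by
  have h := deviation_sub b c S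
  have hpos : 0 < ∑ x ∈ S, x.w := Finset.sum_pos hw hS
  by_contra hlt
  have := mul_pos (sub_pos.2 (not_le.1 hlt)) hpos
  linarith

/-- `V` is an upper set of `S`. -/
def UpperIn (S V : Finset (Pt ℝ)) : Prop :=
  V ⊆ S ∧ ∀ x ∈ V, ∀ z ∈ S, x.pos ≤ z.pos → z ∈ V

/-- `V` is a lower set of `S`. -/
def LowerIn (S V : Finset (Pt ℝ)) : Prop :=
  V ⊆ S ∧ ∀ x ∈ V, ∀ z ∈ S, z.pos ≤ x.pos → z ∈ V

/-- `b` is the mean on `S`, and no upper set of `S` has a larger mean. -/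
def IsFlat (S : Finset (Pt ℝ)) (b : ℝ) : Prop :=
  deviation b S = 0 ∧ ∀ V, UpperIn S V → deviation b V ≤ 0

/-- On a flat block, isotonic functions correlate nonpositively with the residuals. -/
theorem IsFlat.sum_mul_nonpos {S : Finset (Pt ℝ)} {b : ℝ} (hS : IsFlat S b) {h : ℝ × ℕ → ℝ}
    (hh : ∀ x ∈ S, ∀ z ∈ S, x.pos ≤ z.pos → h x.pos ≤ h z.pos) :
    ∑ x ∈ S, x.w * (x.y - b) * (h x.pos - b) ≤ 0 := by
  refine sum_mul_nonpos_of_superlevel S _ (fun x => h x.pos - b) hS.1 fun t => ?_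
  refine hS.2 _ ⟨Finset.filter_subset _ _, fun x hx z hz hxz => ?_⟩
  simp only [Finset.mem_filter] at hx ⊢
  exact ⟨hz, by linarith [hh x hx.1 z hz hxz]⟩

/-- `g` arises on `S` by recursive splitting along maximal upper sets. -/
inductive SplitFit (g : ℝ × ℕ → ℝ) : Finset (Pt ℝ) → Prop
  | flat (S : Finset (Pt ℝ)) (b : ℝ) (hne : S.Nonempty) (hS : IsFlat S b)
      (hg : ∀ x ∈ S, g x.pos = b) : SplitFit g S
  | split (L U : Finset (Pt ℝ)) (b : ℝ) (hL : SplitFit g L) (hU : SplitFit g U)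
      (hLU : Disjoint L U) (hcross : ∀ x ∈ U, ∀ z ∈ L, ¬ x.pos ≤ z.pos)
      (hb : deviation b (L ∪ U) = 0) (hLb : ∀ V, UpperIn L V → deviation b V ≤ 0)
      (hUb : ∀ V, LowerIn U V → 0 ≤ deviation b V) : SplitFit g (L ∪ U)

variable {g : ℝ × ℕ → ℝ} {S : Finset (Pt ℝ)}

theorem SplitFit.nonempty (h : SplitFit g S) : S.Nonempty := by
  induction h with
  | flat S b hne => exact hne
  | split L U b _ _ _ _ _ _ _ ihL => exact ihL.mono Finset.subset_union_left

theorem SplitFit.congr {g' : ℝ × ℕ → ℝ} (h : SplitFit g S) (hg' : ∀ x ∈ S, g' x.pos = g x.pos) :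
    SplitFit g' S := by
  induction h with
  | flat S b hne hS hg => exact .flat S b hne hS fun x hx => (hg' x hx).trans (hg x hx)
  | split L U b _ _ hLU hcross hb hLb hUb ihL ihU =>
    exact .split L U b (ihL fun x hx => hg' x (Finset.mem_union_left _ hx))
      (ihU fun x hx => hg' x (Finset.mem_union_right _ hx)) hLU hcross hb hLb hUb

/-- At a split with mean `b`, the whole set is an upper set of itself, so `b ≤ c`, and the
certificate on `L` bounds the fit there by `b`. Upper sets of `U` are upper sets of the union, so
`U` inherits the hypothesis on `c`. -/
theorem SplitFit.le (h : SplitFit g S) (hw : ∀ x ∈ S, 0 < x.w) {c : ℝ}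
    (hc : ∀ V, UpperIn S V → deviation c V ≤ 0) : ∀ x ∈ S, g x.pos ≤ c := by
  induction h generalizing c with
  | flat S b hne hS hg =>
    intro x hx
    rw [hg x hx]
    exact le_of_deviation_nonpos hne hw hS.1 (hc S ⟨subset_rfl, fun _ _ _ hz _ => hz⟩)
  | split L U b hL hU hLU hcross hb hLb hUb ihL ihU =>
    have hbc : b ≤ c :=
      le_of_deviation_nonpos (hL.nonempty.mono Finset.subset_union_left) hw hb
        (hc _ ⟨subset_rfl, fun _ _ _ hz _ => hz⟩)
    intro x hx
    rcases Finset.mem_union.1 hx with hx | hx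
    · exact (ihL (fun x hx => hw x (Finset.mem_union_left _ hx)) hLb x hx).trans hbc
    · refine ihU (fun x hx => hw x (Finset.mem_union_right _ hx)) (fun V hV => hc V ?_) x hx
      refine ⟨hV.1.trans Finset.subset_union_right, fun a ha z hz haz => ?_⟩
      rcases Finset.mem_union.1 hz with hz | hz
      · exact absurd haz (hcross a (hV.1 ha) z hz)
      · exact hV.2 a ha z hz haz

/-- Dual to `SplitFit.le`: here `L` inherits the hypothesis on `c`, and the fit on `U` is bounded
through `b`. -/
theorem SplitFit.ge (h : SplitFit g S) (hw : ∀ x ∈ S, 0 < x.w) {c : ℝ}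
    (hc : ∀ V, LowerIn S V → 0 ≤ deviation c V) : ∀ x ∈ S, c ≤ g x.pos := by
  induction h generalizing c with
  | flat S b hne hS hg =>
    intro x hx
    rw [hg x hx]
    exact ge_of_deviation_nonneg hne hw hS.1 (hc S ⟨subset_rfl, fun _ _ _ hz _ => hz⟩)
  | split L U b hL hU hLU hcross hb hLb hUb ihL ihU =>
    have hbc : c ≤ b :=
      ge_of_deviation_nonneg (hL.nonempty.mono Finset.subset_union_left) hw hb
        (hc _ ⟨subset_rfl, fun _ _ _ hz _ => hz⟩)
    intro x hx
    rcases Finset.mem_union.1 hx with hx | hx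
    · refine ihL (fun x hx => hw x (Finset.mem_union_left _ hx)) (fun V hV => hc V ?_) x hx
      refine ⟨hV.1.trans Finset.subset_union_left, fun a ha z hz haz => ?_⟩
      rcases Finset.mem_union.1 hz with hz | hz
      · exact hV.2 a ha z hz haz
      · exact absurd haz (hcross z hz a (hV.1 ha))
    · exact hbc.trans (ihU (fun x hx => hw x (Finset.mem_union_right _ hx)) hUb x hx)

/-- The only new comparisons at a split go from `L` up to `U`, and there `b` separates the two fits.
-/
theorem SplitFit.isotonic (h : SplitFit g S) (hw : ∀ x ∈ S, 0 < x.w) :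
    ∀ x ∈ S, ∀ z ∈ S, x.pos ≤ z.pos → g x.pos ≤ g z.pos := by
  induction h with
  | flat S b hne hS hg =>
    intro x hx z hz _
    rw [hg x hx, hg z hz]
  | split L U b hL hU hLU hcross hb hLb hUb ihL ihU =>
    have hwL : ∀ x ∈ L, 0 < x.w := fun x hx => hw x (Finset.mem_union_left _ hx)
    have hwU : ∀ x ∈ U, 0 < x.w := fun x hx => hw x (Finset.mem_union_right _ hx)
    intro x hx z hz hxz
    rcases Finset.mem_union.1 hx with hx | hx <;> rcases Finset.mem_union.1 hz with hz | hz
    · exact ihL hwL x hx z hz hxz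
    · exact (hL.le hwL hLb x hx).trans (hU.ge hwU hUb z hz)
    · exact absurd hxz (hcross x hx z hz)
    · exact ihU hwU x hx z hz hxz

/-- A fit by recursive splitting minimises every additive loss that is minimised by the mean on
each flat block. -/
theorem SplitFit.sum_le {M : Type*} [AddCommMonoid M] [PartialOrder M] [IsOrderedAddMonoid M]
    (h : SplitFit g S) (f₀ f₁ : Pt ℝ → M)
    (hf : ∀ B ⊆ S, ∀ b, B.Nonempty → IsFlat B b → (∀ x ∈ B, g x.pos = b) →
      ∑ x ∈ B, f₀ x ≤ ∑ x ∈ B, f₁ x) :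
    ∑ x ∈ S, f₀ x ≤ ∑ x ∈ S, f₁ x := by
  induction h with
  | flat S b hne hS hg => exact hf S subset_rfl b hne hS hg
  | split L U b hL hU hLU hcross hb hLb hUb ihL ihU =>
    rw [Finset.sum_union hLU, Finset.sum_union hLU]
    exact add_le_add (ihL fun B hB => hf B (hB.trans Finset.subset_union_left))
      (ihU fun B hB => hf B (hB.trans Finset.subset_union_right))

/-- Expanding the square around the block mean leaves a cross term of favourable sign, because
isotonic functions correlate nonpositively with the residuals. -/
theorem SplitFit.sum_sq_le (h : SplitFit g S) (hw : ∀ x ∈ S, 0 < x.w) {f : ℝ × ℕ → ℝ}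
    (hf : ∀ x ∈ S, ∀ z ∈ S, x.pos ≤ z.pos → f x.pos ≤ f z.pos) :
    ∑ x ∈ S, x.w * (g x.pos - x.y) ^ 2 ≤ ∑ x ∈ S, x.w * (f x.pos - x.y) ^ 2 := by
  refine h.sum_le _ _ fun B hB b _ hflat hg => ?_
  have h₁ := hflat.sum_mul_nonpos fun x hx z hz => hf x (hB hx) z (hB hz)
  have h₂ : ∑ x ∈ B, x.w * (f x.pos - x.y) ^ 2 =
      ∑ x ∈ B, x.w * (g x.pos - x.y) ^ 2 + ∑ x ∈ B, x.w * (f x.pos - b) ^ 2 -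
        2 * ∑ x ∈ B, x.w * (x.y - b) * (f x.pos - b) := by
    rw [Finset.mul_sum, ← Finset.sum_add_distrib, ← Finset.sum_sub_distrib]
    refine Finset.sum_congr rfl fun x hx => ?_
    rw [hg x hx]
    ring
  have h₃ : 0 ≤ ∑ x ∈ B, x.w * (f x.pos - b) ^ 2 :=
    Finset.sum_nonneg fun x hx => mul_nonneg (hw x (hB hx)).le (sq_nonneg _)
  linarith

/-- For values in `[0,1]`, every set has nonnegative deviation from 0 and nonpositive deviation from
1, so these levels bound the fit. -/
theorem SplitFit.mem_Icc (h : SplitFit g S) (hw : ∀ x ∈ S, 0 < x.w)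
    (hy : ∀ x ∈ S, x.y ∈ Set.Icc (0 : ℝ) 1) : ∀ x ∈ S, g x.pos ∈ Set.Icc (0 : ℝ) 1 := by
  intro x hx
  constructor
  · refine h.ge hw (fun V hV => Finset.sum_nonneg fun z hz => ?_) x hx
    exact mul_nonneg (hw z (hV.1 hz)).le (by linarith [(hy z (hV.1 hz)).1])
  · refine h.le hw (fun V hV => Finset.sum_nonpos fun z hz => ?_) x hx
    exact mul_nonpos_of_nonneg_of_nonpos (hw z (hV.1 hz)).le (by linarith [(hy z (hV.1 hz)).2])

end Blocks

/-! ### The logarithmic loss -/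

section LogLoss

/-- The Bernoulli negative log-likelihood of `t` for the observation `y`. -/
noncomputable def logLoss (y t : ℝ) : ENNReal :=
  ENNReal.ofReal y * negLog t + ENNReal.ofReal (1 - y) * negLog (1 - t)

/-- The tangent bound for `-log` at `b`. -/
theorem ofReal_le_negLog {b t : ℝ} (hb : 0 < b) :
    ENNReal.ofReal (-Real.log b - (t - b) / b) ≤ negLog t := by
  unfold negLog
  split_ifs with ht
  · refine ENNReal.ofReal_le_ofReal ?_
    have h := Real.log_le_sub_one_of_pos (div_pos ht hb)
    rw [Real.log_div ht.ne' hb.ne'] at h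
    have : (t - b) / b = t / b - 1 := by field_simp
    linarith
  · exact le_top

theorem ofReal_sum_le {ι : Type*} (S : Finset ι) (f : ι → ℝ) :
    ENNReal.ofReal (∑ x ∈ S, f x) ≤ ∑ x ∈ S, ENNReal.ofReal (f x) :=
  Finset.le_sum_of_subadditive ENNReal.ofReal ENNReal.ofReal_zero.le
    (fun _ _ => ENNReal.ofReal_add_le) S f

theorem logLoss_zero_zero : logLoss 0 0 = 0 := by simp [logLoss, negLog]

theorem logLoss_one_one : logLoss 1 1 = 0 := by simp [logLoss, negLog]

theorem logLoss_eq_ofReal {y b : ℝ} (hy : y ∈ Set.Icc (0 : ℝ) 1) (hb : b ∈ Set.Ioo (0 : ℝ) 1) :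
    logLoss y b = ENNReal.ofReal (y * -Real.log b + (1 - y) * -Real.log (1 - b)) := by
  have h₁ : 0 ≤ -Real.log b := by linarith [Real.log_nonpos hb.1.le hb.2.le]
  have h₂ : 0 ≤ -Real.log (1 - b) := by
    linarith [Real.log_nonpos (x := 1 - b) (by linarith [hb.2]) (by linarith [hb.1])]
  have h₃ : 0 ≤ 1 - y := by linarith [hy.2]
  rw [logLoss, negLog, negLog, if_pos hb.1, if_pos (by linarith [hb.2] : 0 < 1 - b),
    ENNReal.ofReal_add (mul_nonneg hy.1 h₁) (mul_nonneg h₃ h₂), ENNReal.ofReal_mul hy.1,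
    ENNReal.ofReal_mul h₃]

/-- The tangent bound for the logarithmic loss at `b`. -/
theorem ofReal_le_logLoss {y b t : ℝ} (hy : y ∈ Set.Icc (0 : ℝ) 1) (hb : b ∈ Set.Ioo (0 : ℝ) 1) :
    ENNReal.ofReal (y * -Real.log b + (1 - y) * -Real.log (1 - b) -
      (y - b) * (t - b) / (b * (1 - b))) ≤ logLoss y t := by
  have hb' : 0 < 1 - b := by linarith [hb.2]
  have h₃ : 0 ≤ 1 - y := by linarith [hy.2]
  have key : y * -Real.log b + (1 - y) * -Real.log (1 - b) - (y - b) * (t - b) / (b * (1 - b)) =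
      y * (-Real.log b - (t - b) / b) +
        (1 - y) * (-Real.log (1 - b) - (1 - t - (1 - b)) / (1 - b)) := by
    have := hb.1.ne'
    have := hb'.ne'
    field_simp
    ring
  rw [key]
  refine ENNReal.ofReal_add_le.trans ?_
  rw [ENNReal.ofReal_mul hy.1, ENNReal.ofReal_mul h₃]
  exact add_le_add (mul_le_mul_right (ofReal_le_negLog hb.1) _)
    (mul_le_mul_right (ofReal_le_negLog hb') _)

/-- The linear term of the tangent bound at `b` is a negative multiple of `(y - b) * (t - b)`; its
weighted sum over a flat block is nonnegative for every isotonic competitor. -/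
theorem SplitFit.sum_logLoss_le {g : ℝ × ℕ → ℝ} {S : Finset (Pt ℝ)} (h : SplitFit g S)
    (hw : ∀ x ∈ S, 0 < x.w) (hy : ∀ x ∈ S, x.y ∈ Set.Icc (0 : ℝ) 1) {f : ℝ × ℕ → ℝ}
    (hf : ∀ x ∈ S, ∀ z ∈ S, x.pos ≤ z.pos → f x.pos ≤ f z.pos) :
    ∑ x ∈ S, ENNReal.ofReal x.w * logLoss x.y (g x.pos) ≤
      ∑ x ∈ S, ENNReal.ofReal x.w * logLoss x.y (f x.pos) := by
  refine h.sum_le _ _ fun B hB b hne hflat hg => ?_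
  have hwB : ∀ x ∈ B, 0 < x.w := fun x hx => hw x (hB hx)
  have hyB : ∀ x ∈ B, x.y ∈ Set.Icc (0 : ℝ) 1 := fun x hx => hy x (hB hx)
  obtain ⟨x₀, hx₀⟩ := hne
  have hb : b ∈ Set.Icc (0 : ℝ) 1 := hg x₀ hx₀ ▸ h.mem_Icc hw hy x₀ (hB hx₀)
  have hdev : ∑ x ∈ B, x.w * (x.y - b) = 0 := hflat.1
  -- The tangent needs `0 < b < 1`. If the mean is 0 or 1, all values on the block equal it, and the
  -- loss of the fit vanishes by `0 * ∞ = 0`.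
  rcases hb.1.eq_or_lt with rfl | hb₀
  · have h₀ := (Finset.sum_eq_zero_iff_of_nonneg fun x hx =>
      mul_nonneg (hwB x hx).le (by linarith [(hyB x hx).1])).1 hdev
    rw [Finset.sum_eq_zero fun x hx => ?_]
    · exact zero_le
    have : x.y = 0 := by
      have := (mul_eq_zero.1 (h₀ x hx)).resolve_left (hwB x hx).ne'
      linarith
    rw [hg x hx, this, logLoss_zero_zero, mul_zero]
  rcases hb.2.eq_or_lt with rfl | hb₁
  · have h₀ := (Finset.sum_eq_zero_iff_of_nonpos fun x hx =>
      mul_nonpos_of_nonneg_of_nonpos (hwB x hx).le (by linarith [(hyB x hx).2])).1 hdev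
    rw [Finset.sum_eq_zero fun x hx => ?_]
    · exact zero_le
    have : x.y = 1 := by
      have := (mul_eq_zero.1 (h₀ x hx)).resolve_left (hwB x hx).ne'
      linarith
    rw [hg x hx, this, logLoss_one_one, mul_zero]
  have hb : b ∈ Set.Ioo (0 : ℝ) 1 := ⟨hb₀, hb₁⟩
  set ℓ : ℝ → ℝ := fun y => y * -Real.log b + (1 - y) * -Real.log (1 - b) with hℓ
  have hℓ₀ : ∀ x ∈ B, 0 ≤ ℓ x.y := fun x hx => by
    have h₁ := Real.log_nonpos hb₀.le hb₁.le
    have h₂ := Real.log_nonpos (x := 1 - b) (by linarith) (by linarith)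
    have h₃ := hyB x hx
    exact add_nonneg (mul_nonneg h₃.1 (by linarith)) (mul_nonneg (by linarith [h₃.2]) (by linarith))
  calc ∑ x ∈ B, ENNReal.ofReal x.w * logLoss x.y (g x.pos)
      = ∑ x ∈ B, ENNReal.ofReal (x.w * ℓ x.y) := Finset.sum_congr rfl fun x hx => by
        rw [hg x hx, logLoss_eq_ofReal (hyB x hx) hb, ENNReal.ofReal_mul (hwB x hx).le]
    _ = ENNReal.ofReal (∑ x ∈ B, x.w * ℓ x.y) :=
        (ENNReal.ofReal_sum_of_nonneg fun x hx => mul_nonneg (hwB x hx).le (hℓ₀ x hx)).symm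
    _ ≤ ENNReal.ofReal
        (∑ x ∈ B, x.w * (ℓ x.y - (x.y - b) * (f x.pos - b) / (b * (1 - b)))) := by
        refine ENNReal.ofReal_le_ofReal ?_
        have h₁ := hflat.sum_mul_nonpos fun x hx z hz => hf x (hB hx) z (hB hz)
        have h₂ : ∑ x ∈ B, x.w * (ℓ x.y - (x.y - b) * (f x.pos - b) / (b * (1 - b))) =
            ∑ x ∈ B, x.w * ℓ x.y -
              (∑ x ∈ B, x.w * (x.y - b) * (f x.pos - b)) / (b * (1 - b)) := by
          rw [Finset.sum_div, ← Finset.sum_sub_distrib]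
          exact Finset.sum_congr rfl fun x _ => by ring
        have h₃ := div_nonpos_of_nonpos_of_nonneg h₁ (mul_pos hb₀ (sub_pos.2 hb₁)).le
        linarith
    -- Single tangent values may be negative, so `ENNReal.ofReal` is only subadditive here, which is
    -- the direction needed.
    _ ≤ ∑ x ∈ B, ENNReal.ofReal
        (x.w * (ℓ x.y - (x.y - b) * (f x.pos - b) / (b * (1 - b)))) := ofReal_sum_le _ _
    _ ≤ ∑ x ∈ B, ENNReal.ofReal x.w * logLoss x.y (f x.pos) := by
        refine Finset.sum_le_sum fun x hx => ?_
        rw [ENNReal.ofReal_mul (hwB x hx).le]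
        exact mul_le_mul_right (ofReal_le_logLoss (hyB x hx) hb) _

end LogLoss

/-! ### Correctness and cost of recursive splitting -/

section Splitting

open scoped Classical

variable {k : ℕ} {X L U : List (Pt ℝ)}

theorem IsGrid.excess_eq_deviation (hX : IsGrid k X) (hU : U.Sublist X) :
    excess X U = deviation (avg X) U.toFinset :=
  (List.sum_toFinset _ (hX.sublist hU).nodup).symm

theorem IsGrid.deviation_avg (hX : IsGrid k X) (hX₀ : X ≠ []) :
    deviation (avg X) X.toFinset = 0 := by
  have hne : X.toFinset.Nonempty := List.toFinset_nonempty_iff X |>.2 hX₀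
  have hpos : 0 < ∑ x ∈ X.toFinset, x.w :=
    Finset.sum_pos (fun x hx => (hX.2 x (List.mem_toFinset.1 hx)).2.2) hne
  have havg : avg X = (∑ x ∈ X.toFinset, x.w * x.y) / ∑ x ∈ X.toFinset, x.w := by
    rw [avg, List.sum_toFinset _ hX.nodup, List.sum_toFinset _ hX.nodup]
  simp only [deviation, mul_sub, Finset.sum_sub_distrib, ← Finset.sum_mul]
  rw [havg]
  field_simp
  simp

theorem IsMaximalUpperSet.deviation_le (hX : IsGrid k X) (hU : IsMaximalUpperSet X U)
    {V : Finset (Pt ℝ)} (hV : UpperIn X.toFinset V) :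
    deviation (avg X) V ≤ deviation (avg X) U.toFinset := by
  have hfin : (X.filter (· ∈ V)).toFinset = V := by
    ext x
    simp only [List.mem_toFinset, List.mem_filter, decide_eq_true_eq, and_iff_right_iff_imp]
    exact fun hx => List.mem_toFinset.1 (hV.1 hx)
  have hsub : (X.filter (· ∈ V)).Sublist X := List.filter_sublist
  have h := hU.2 (X.filter (· ∈ V)) ⟨hsub, fun x hx z hz hxz => by
    simp only [List.mem_filter, decide_eq_true_eq] at hx ⊢
    exact ⟨hz, hV.2 x hx.2 z (List.mem_toFinset.2 hz) hxz⟩⟩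
  rwa [hX.excess_eq_deviation hsub, hX.excess_eq_deviation hU.1.1, hfin] at h

/-- Both the empty set and `X` have excess 0, so maximality of a trivial `U` is flatness. -/
theorem IsMaximalUpperSet.isFlat (hX : IsGrid k X) (hX₀ : X ≠ []) (hU : IsMaximalUpperSet X U)
    (hLU : (L ++ U).Perm X) (h : L = [] ∨ U = []) : IsFlat X.toFinset (avg X) := by
  have h₀ := hX.deviation_avg hX₀
  refine ⟨h₀, fun V hV => (hU.deviation_le hX hV).trans_eq ?_⟩
  rcases h with rfl | rfl
  · rw [List.nil_append] at hLU
    rw [List.toFinset_eq_of_perm _ _ hLU, h₀]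
  · simp [deviation]

theorem disjoint_of_append_perm (hX : IsGrid k X) (hLU : (L ++ U).Perm X) :
    Disjoint L.toFinset U.toFinset := by
  have := (hLU.nodup_iff.2 hX.nodup)
  rw [List.nodup_append'] at this
  exact List.disjoint_toFinset_iff_disjoint.2 this.2.2

theorem toFinset_union_of_append_perm (hLU : (L ++ U).Perm X) :
    L.toFinset ∪ U.toFinset = X.toFinset := by
  rw [← List.toFinset_append, List.toFinset_eq_of_perm _ _ hLU]

theorem IsMaximalUpperSet.not_pos_le (hX : IsGrid k X) (hU : IsMaximalUpperSet X U)
    (hLU : (L ++ U).Perm X) : ∀ x ∈ U, ∀ z ∈ L, ¬ x.pos ≤ z.pos := by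
  intro x hx z hz hxz
  have hzU := hU.1.2 x hx z (hLU.subset (List.mem_append_left U hz)) hxz
  exact Finset.disjoint_left.1 (disjoint_of_append_perm hX hLU) (List.mem_toFinset.2 hz)
    (List.mem_toFinset.2 hzU)

/-- Every upper set of the complement of a maximal upper set has mean at most `avg X`. -/
theorem IsMaximalUpperSet.deviation_nonpos (hX : IsGrid k X) (hU : IsMaximalUpperSet X U)
    (hLU : (L ++ U).Perm X) {V : Finset (Pt ℝ)} (hV : UpperIn L.toFinset V) :
    deviation (avg X) V ≤ 0 := by
  have hun := toFinset_union_of_append_perm hLU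
  -- The competitor that adds `V` to `U` cannot have larger excess than `U`.
  have hup : UpperIn X.toFinset (V ∪ U.toFinset) := by
    rw [← hun]
    refine ⟨Finset.union_subset_union_left hV.1, fun x hx z hz hxz => ?_⟩
    rcases Finset.mem_union.1 hz with hz | hz
    · rcases Finset.mem_union.1 hx with hx | hx
      · exact Finset.mem_union_left _ (hV.2 x hx z hz hxz)
      · exact absurd hxz (hU.not_pos_le hX hLU x (List.mem_toFinset.1 hx) z
          (List.mem_toFinset.1 hz))
    · exact Finset.mem_union_right _ hz
  have h := hU.deviation_le hX hup
  rw [deviation_union _ ((disjoint_of_append_perm hX hLU).mono_left hV.1)] at h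
  linarith

/-- Every lower set of a maximal upper set has mean at least `avg X`. -/
theorem IsMaximalUpperSet.deviation_nonneg (hX : IsGrid k X) (hU : IsMaximalUpperSet X U)
    (hLU : (L ++ U).Perm X) {V : Finset (Pt ℝ)} (hV : LowerIn U.toFinset V) :
    0 ≤ deviation (avg X) V := by
  have hun := toFinset_union_of_append_perm hLU
  -- The competitor that removes `V` from `U` cannot have larger excess than `U`.
  have hup : UpperIn X.toFinset (U.toFinset \ V) := by
    rw [← hun]
    refine ⟨Finset.sdiff_subset.trans Finset.subset_union_right, fun x hx z hz hxz => ?_⟩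
    rw [Finset.mem_sdiff] at hx
    rcases Finset.mem_union.1 hz with hz | hz
    · exact absurd hxz (hU.not_pos_le hX hLU x (List.mem_toFinset.1 hx.1) z
        (List.mem_toFinset.1 hz))
    · exact Finset.mem_sdiff.2 ⟨hz, fun hzV => hx.2 (hV.2 z hzV x hx.1 hxz)⟩
  have h := hU.deviation_le hX hup
  have h' := deviation_union (avg X) (Finset.sdiff_disjoint (s := V) (t := U.toFinset))
  rw [Finset.sdiff_union_of_subset hV.1] at h'
  linarith

theorem splitSolveT_spec (depth : ℕ) (X : List (Pt ℝ)) (hd : X.length ≤ depth) (hX₀ : X ≠ [])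
    (hX : IsGrid k X) :
    ∃ g : ℝ × ℕ → ℝ, SplitFit g X.toFinset ∧
      (splitSolveT k depth X).val.Perm (X.map fun x => (x.pos, g x.pos)) ∧
      (splitSolveT k depth X).steps ≤ 60 * (X.length ^ 2 * k) := by
  induction depth generalizing X with
  | zero => exact absurd (List.length_eq_zero_iff.1 (Nat.le_zero.1 hd)) hX₀
  | succ depth ih =>
    have hk : 0 < k := by
      obtain ⟨x, hx⟩ := List.exists_mem_of_ne_nil X hX₀
      have := hX.2 x hx
      lia
    have hn : 0 < X.length := List.length_pos_iff.2 hX₀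
    have hsteps := maxUpperSetT_steps_le k hk X hX₀
    obtain ⟨L, U, hM⟩ : ∃ L U, (maxUpperSetT k X).val = (L, U) := ⟨_, _, rfl⟩
    obtain ⟨hLU, hL, hU⟩ := maxUpperSetT_spec hX hX₀ hM
    by_cases htriv : L = [] ∨ U = []
    · have hconst : splitSolveT k (depth + 1) X = (do
          tick
          let _ ← maxUpperSetT k X
          let b ← avgT X
          constantT b X) := by
        rcases htriv with rfl | rfl
        · simp only [splitSolveT, bind, hM]
        · cases L <;> simp only [splitSolveT, bind, hM]
      rw [hconst]
      refine ⟨fun _ => avg X, .flat _ (avg X) ((List.toFinset_nonempty_iff X).2 hX₀)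
        (hU.isFlat hX hX₀ hLU htriv) fun _ _ => rfl, ?_, ?_⟩
      · simp [constantT_val, Pt.pos]
      · simp only [bind_steps, tick_steps, avgT_steps, constantT_steps]
        have h₁ : X.length * 1 ≤ X.length * k := by gcongr; exact hk
        have h₂ : X.length * k ≤ X.length ^ 2 * k := by
          gcongr
          exact Nat.le_self_pow (by simp) _
        lia
    · rw [not_or] at htriv
      have hlen := hLU.length_eq
      rw [List.length_append] at hlen
      have hL₀ : 0 < L.length := List.length_pos_iff.2 htriv.1
      have hU₀ : 0 < U.length := List.length_pos_iff.2 htriv.2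
      obtain ⟨gL, hgL, hpL, hsL⟩ := ih L (by lia) htriv.1 (hX.sublist hL)
      obtain ⟨gU, hgU, hpU, hsU⟩ := ih U (by lia) htriv.2 (hX.sublist hU.1.1)
      have hrec : splitSolveT k (depth + 1) X = (do
          tick
          let _ ← maxUpperSetT k X
          let fL ← splitSolveT k depth L
          let fU ← splitSolveT k depth U
          appendT fL fU) := by
        cases L with
        | nil => exact absurd rfl htriv.1
        | cons l L =>
          cases U with
          | nil => exact absurd rfl htriv.2
          | cons u U => simp only [splitSolveT, bind, hM]
      have hdisj := disjoint_of_append_perm hX hLU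
      -- Gluing by position is consistent because grid positions are distinct.
      set g : ℝ × ℕ → ℝ := fun s => if s ∈ L.map Pt.pos then gL s else gU s with hg
      have hL' : ∀ x ∈ L, g x.pos = gL x.pos := fun x hx =>
        if_pos (List.mem_map_of_mem hx)
      have hU' : ∀ x ∈ U, g x.pos = gU x.pos := fun x hx => by
        refine if_neg fun hmem => ?_
        obtain ⟨z, hz, hzx⟩ := List.mem_map.1 hmem
        have := hX.eq_of_pos_eq (hL.subset hz) (hU.1.1.subset hx) hzx
        subst this
        exact Finset.disjoint_left.1 hdisj (List.mem_toFinset.2 hz) (List.mem_toFinset.2 hx)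
      rw [hrec]
      refine ⟨g, ?_, ?_, ?_⟩
      · have hun := toFinset_union_of_append_perm hLU
        rw [← hun]
        refine .split _ _ (avg X) (hgL.congr fun x hx => hL' x (List.mem_toFinset.1 hx))
          (hgU.congr fun x hx => hU' x (List.mem_toFinset.1 hx)) hdisj ?_ ?_ ?_ ?_
        · exact fun x hx z hz => hU.not_pos_le hX hLU x (List.mem_toFinset.1 hx) z
            (List.mem_toFinset.1 hz)
        · rw [hun]
          exact hX.deviation_avg hX₀
        · exact fun V hV => hU.deviation_nonpos hX hLU hV
        · exact fun V hV => hU.deviation_nonneg hX hLU hV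
      · simp only [bind_val, appendT_val]
        refine List.Perm.trans ?_ (hLU.map _)
        rw [List.map_append]
        refine List.Perm.append (hpL.trans (List.Perm.of_eq ?_)) (hpU.trans (List.Perm.of_eq ?_))
        · exact List.map_congr_left fun x hx => by rw [hL' x hx]
        · exact List.map_congr_left fun x hx => by rw [hU' x hx]
      · simp only [bind_steps, tick_steps, appendT_steps, hpL.length_eq, List.length_map]
        rw [← hlen] at hsteps ⊢
        generalize L.length = a at *
        generalize U.length = c at *
        -- Since `a, c ≥ 1`, the cross term of `(a + c) ^ 2` dominates `a + c` and so pays for the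
        -- split and the concatenation.
        have h₁ : a + c ≤ 2 * (a * c) := by nlinarith
        have h₂ : (a + c) * k ≤ 2 * (a * c) * k := by gcongr
        have h₃ : (a + c) * 1 ≤ (a + c) * k := by gcongr; exact hk
        have h₄ : (a + c) ^ 2 * k = a ^ 2 * k + c ^ 2 * k + 2 * (a * c) * k := by ring
        rw [h₄]
        lia

theorem isotonicOn_iff {S : List (Pt ℝ)} {f : ℝ × ℕ → ℝ} :
    IsotonicOn S f ↔
      ∀ x ∈ S.toFinset, ∀ z ∈ S.toFinset, x.pos ≤ z.pos → f x.pos ≤ f z.pos := by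
  simp [IsotonicOn]

theorem IsGrid.pos_weight_toFinset (hX : IsGrid k X) : ∀ x ∈ X.toFinset, 0 < x.w :=
  fun x hx => (hX.2 x (List.mem_toFinset.1 hx)).2.2

theorem SplitFit.isIsotonicRegression (hX : IsGrid k X) {g : ℝ × ℕ → ℝ}
    (h : SplitFit g X.toFinset) : IsIsotonicRegression X g := by
  refine ⟨isotonicOn_iff.2 (h.isotonic hX.pos_weight_toFinset), fun f hf => ?_⟩
  rw [← List.sum_toFinset _ hX.nodup, ← List.sum_toFinset _ hX.nodup]
  exact h.sum_sq_le hX.pos_weight_toFinset (isotonicOn_iff.1 hf)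

/-- The regressions on the two parts are their own fits by recursive splitting; the mean of `X`
separates them. -/
theorem IsMaximalUpperSet.isProjectionPair (hX : IsGrid k X) (hU : IsMaximalUpperSet X U)
    (hLU : (L ++ U).Perm X) (hL : L.Sublist X) (hL₀ : L ≠ []) (hU₀ : U ≠ []) :
    IsProjectionPair X L U := by
  have hLg := hX.sublist hL
  have hUg := hX.sublist hU.1.1
  obtain ⟨fL, hfL, -⟩ := splitSolveT_spec L.length L le_rfl hL₀ hLg
  obtain ⟨fU, hfU, -⟩ := splitSolveT_spec U.length U le_rfl hU₀ hUg
  refine ⟨hLU, ⟨hL, fun x hx z hz hzx => ?_⟩, hU.1, fL, fU, hfL.isIsotonicRegression hLg,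
    hfU.isIsotonicRegression hUg, avg X, fun x hx z hz => ⟨?_, ?_⟩⟩
  · rcases List.mem_append.1 (hLU.mem_iff.2 hz) with hz | hz
    · exact hz
    · exact absurd hzx (hU.not_pos_le hX hLU z hz x hx)
  · exact hfL.le hLg.pos_weight_toFinset (fun V hV => hU.deviation_nonpos hX hLU hV) x
      (List.mem_toFinset.2 hx)
  · exact hfU.ge hUg.pos_weight_toFinset (fun V hV => hU.deviation_nonneg hX hLU hV) z
      (List.mem_toFinset.2 hz)

end Splitting

/-! ### Aggregation of the calibration data -/

section Aggregation

/-- Decreasing score, then increasing key. -/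
def ClassEntry.Before (a b : ClassEntry ℝ) : Prop :=
  b.score < a.score ∨ (a.score = b.score ∧ a.tie < b.tie)

theorem classBeforeT_val (a b : ClassEntry ℝ) :
    (classBeforeT a b).val = true ↔ a.Before b := by
  simp only [classBeforeT, bind_val, ltT_val, decide_eq_true_eq, ClassEntry.Before]
  split
  · simp_all
  · simp only [bind_val, ltT_val, decide_eq_true_eq]
    split
    next h => simp [h.ne, h.le]
    next h h' =>
      have : a.score = b.score := le_antisymm (not_lt.1 h) (not_lt.1 h')
      simp [this]

/-- The classes of a calibration point, sorted by their ranks. -/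
theorem sortT_classBeforeT {k : ℕ} {p : Fin k → ℝ} {σ : Equiv.Perm (Fin k)} (hσ : IsOrderPerm p σ)
    (y : Fin k → ℝ) :
    (sortT classBeforeT (List.ofFn fun j => (⟨p j, σ j, y j⟩ : ClassEntry ℝ))).val =
      List.ofFn fun r => ⟨p (σ.symm r), r, y (σ.symm r)⟩ := by
  -- With the key `σ j` breaking ties, the classes are strictly linearly ordered, so the list in
  -- rank order is the only possible result of sorting.
  refine List.Perm.eq_of_pairwise (le := ClassEntry.Before) ?_ ?_ ?_ ?_
  · rintro a b - - (h | h) (h' | h')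
    · exact absurd h h'.not_gt
    · exact absurd h'.1 h.ne
    · exact absurd h.1 h'.ne
    · exact absurd h.2 h'.2.not_gt
  · refine sortT_pairwise _ _ ?_ _ (fun a _ b _ => (classBeforeT_val a b).1) ?_
    · rintro a b c (h | h) (h' | h')
      · exact Or.inl (h'.trans h)
      · exact Or.inl (h'.1 ▸ h)
      · exact Or.inl (h.1 ▸ h')
      · exact Or.inr ⟨h.1.trans h'.1, h.2.trans h'.2⟩
    -- Only entries of different classes are compared; their keys differ, so a failed comparison
    -- gives the strict relation the other way round.
    · rw [List.pairwise_ofFn]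
      intro i j hij h
      rw [← Bool.not_eq_true, classBeforeT_val] at h
      simp only [ClassEntry.Before, not_or, not_and, not_lt] at h ⊢
      rcases h.1.lt_or_eq with h' | h'
      · exact Or.inl h'
      · refine Or.inr ⟨h'.symm, lt_of_le_of_ne (h.2 h') fun he => hij.ne ?_⟩
        exact (σ.injective (Fin.ext he)).symm
  · rw [List.pairwise_ofFn]
    intro i j hij
    rcases (hσ hij.le).lt_or_eq with h | h
    · exact Or.inl h
    · exact Or.inr ⟨h.symm, hij⟩
  · refine (sortT_perm _ _).trans ?_
    have := Equiv.Perm.ofFn_comp_perm σ.symm fun j => (⟨p j, σ j, y j⟩ : ClassEntry ℝ)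
    refine this.symm.trans (List.Perm.of_eq ?_)
    congr 1
    funext r
    simp

theorem cumulateT_val (r : ℕ) (q y : ℝ) (l : List (ClassEntry ℝ)) :
    (cumulateT r q y l).val = (List.range (l.length - 1)).map fun t =>
      ⟨q + ((l.map ClassEntry.score).take (t + 1)).sum, r + t + 1,
        y + ((l.map ClassEntry.label).take (t + 1)).sum, 1⟩ := by
  induction l generalizing r q y with
  | nil => simp [cumulateT]
  | cons e l ih =>
    cases l with
    | nil => simp [cumulateT]
    | cons e' l =>
      simp only [cumulateT, bind_val, succT_val, addT_val, consT_val, ih, List.length_cons,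
        Nat.add_sub_cancel, List.range_succ_eq_map, List.map_cons, List.map_map]
      congr 1
      · simp
      · refine List.map_congr_left fun t _ => ?_
        simp [add_assoc, add_comm, add_left_comm]

theorem topSum_eq {k : ℕ} (σ : Equiv.Perm (Fin k)) (v : Fin k → ℝ) (r : ℕ) :
    topSum σ v r = ((List.ofFn fun s => v (σ.symm s)).take r).sum := by
  rw [List.sum_take_ofFn, topSum]
  refine Finset.sum_equiv σ (fun j => ?_) fun j _ => by simp
  simp

theorem topSum_mem_Icc {k : ℕ} (σ : Equiv.Perm (Fin k)) {v : Fin k → ℝ}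
    (hv : v ∈ stdSimplex ℝ (Fin k)) (r : ℕ) : topSum σ v r ∈ Set.Icc (0 : ℝ) 1 :=
  ⟨Finset.sum_nonneg fun j _ => hv.1 j,
    (Finset.sum_le_sum_of_subset_of_nonneg (Finset.filter_subset _ _) fun j _ _ => hv.1 j).trans
      hv.2.le⟩

theorem oneHot_mem_stdSimplex {k : ℕ} (c : Fin k) : oneHot c ∈ stdSimplex ℝ (Fin k) :=
  single_mem_stdSimplex ℝ c

/-- The sorted cumulative data of one calibration point. -/
noncomputable def cumulativeData {k : ℕ} (p y : Fin k → ℝ) (σ : Equiv.Perm (Fin k)) :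
    List (Pt ℝ) :=
  (List.range (k - 1)).map fun t => ⟨topSum σ p (t + 1), t + 1, topSum σ y (t + 1), 1⟩

theorem collectT_inputData {m k : ℕ} (p y : Fin m → Fin k → ℝ) (σ : Fin m → Equiv.Perm (Fin k))
    (hσ : ∀ i, IsOrderPerm (p i) (σ i)) :
    (collectT (inputData p y σ)).val =
      (List.ofFn fun i => cumulativeData (p i) (y i) (σ i)).flatten := by
  have hcol (V : List (List (ClassEntry ℝ))) : (collectT V).val =
      (V.map fun s => (cumulateT 0 0 0 (sortT classBeforeT s).val).val).flatten := by
    induction V with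
    | nil => simp [collectT]
    | cons s V ih => simp [collectT, ih]
  rw [hcol, inputData, List.map_ofFn]
  congr 2
  funext i
  simp only [Function.comp_apply]
  rw [sortT_classBeforeT (hσ i), cumulateT_val, cumulativeData, List.length_ofFn]
  refine List.map_congr_left fun t _ => ?_
  simp only [List.map_ofFn, topSum_eq, zero_add]
  rfl

/-- The order used for sorting the data points. -/
def Pt.LexLe (a b : Pt ℝ) : Prop := a.q < b.q ∨ (a.q = b.q ∧ a.r ≤ b.r)

theorem Pt.LexLe.trans {a b c : Pt ℝ} : a.LexLe b → b.LexLe c → a.LexLe c := by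
  rintro (h | h) (h' | h')
  · exact Or.inl (h.trans h')
  · exact Or.inl (h'.1 ▸ h)
  · exact Or.inl (h.1 ▸ h')
  · exact Or.inr ⟨h.1.trans h'.1, h.2.trans h'.2⟩

theorem Pt.LexLe.trans_lt {a b c : Pt ℝ} : a.LexLe b → b.LexLt c → a.LexLt c := by
  rintro (h | h) (h' | h')
  · exact Or.inl (h.trans h')
  · exact Or.inl (h'.1 ▸ h)
  · exact Or.inl (h.1 ▸ h')
  · exact Or.inr ⟨h.1.trans h'.1, h.2.trans_lt h'.2⟩

theorem Pt.LexLe.lt_of_pos_ne {a b : Pt ℝ} (h : a.LexLe b) (hne : a.pos ≠ b.pos) :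
    a.LexLt b := by
  rcases h with h | h
  · exact Or.inl h
  · exact Or.inr ⟨h.1, lt_of_le_of_ne h.2 fun h' => hne (Prod.ext h.1 h')⟩

theorem ptBeforeT_val (a b : Pt ℝ) : (ptBeforeT a b).val = true ↔ a.LexLt b := by
  simp only [ptBeforeT, bind_val, ltT_val, decide_eq_true_eq, Pt.LexLt]
  split
  · simp_all
  · simp only [bind_val, ltT_val, decide_eq_true_eq]
    split
    next h => simp [h.ne', h.le]
    next h h' =>
      have : a.q = b.q := le_antisymm (not_lt.1 h') (not_lt.1 h)
      simp [this]

theorem samePosT_val (a b : Pt ℝ) : (samePosT a b).val = true ↔ a.pos = b.pos := by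
  simp only [samePosT, bind_val, ltT_val, decide_eq_true_eq, Pt.pos, Prod.mk.injEq]
  split
  next h => simp [h.ne]
  · simp only [bind_val, ltT_val, decide_eq_true_eq]
    split
    next h => simp [h.ne']
    next h h' =>
      have : a.q = b.q := le_antisymm (not_lt.1 h') (not_lt.1 h)
      simp [this]

theorem sortT_ptBeforeT_pairwise (X : List (Pt ℝ)) :
    (sortT ptBeforeT X).val.Pairwise Pt.LexLe := by
  refine sortT_pairwise _ Pt.LexLe (fun _ _ _ => Pt.LexLe.trans) _ (fun a _ b _ h => ?_)
    (List.pairwise_of_forall fun a b h => ?_)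
  · exact ((ptBeforeT_val a b).1 h).imp_right fun h => ⟨h.1, h.2.le⟩
  · rw [← Bool.not_eq_true, ptBeforeT_val] at h
    simp only [Pt.LexLt, not_or, not_and, not_lt] at h
    rcases h.1.lt_or_eq with h' | h'
    · exact Or.inl h'
    · exact Or.inr ⟨h', h.2 h'.symm⟩

/-- A data point with positive weight and value in `[0,1]`. -/
def Pt.IsProper (x : Pt ℝ) : Prop := 0 < x.w ∧ x.y ∈ Set.Icc (0 : ℝ) 1

theorem poolT_val (a b : Pt ℝ) :
    (poolT a b).val = ⟨a.q, a.r, (a.w * a.y + b.w * b.y) / (a.w + b.w), a.w + b.w⟩ := rfl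

theorem poolT_isProper {a b : Pt ℝ} (ha : a.IsProper) (hb : b.IsProper) :
    (poolT a b).val.IsProper := by
  obtain ⟨ha, ha₀, ha₁⟩ := ha
  obtain ⟨hb, hb₀, hb₁⟩ := hb
  rw [poolT_val]
  refine ⟨add_pos ha hb, div_nonneg (by positivity) (by positivity), ?_⟩
  rw [div_le_one (by positivity)]
  nlinarith

theorem ofReal_mul_logLoss {w y : ℝ} (hw : 0 ≤ w) (t : ℝ) :
    ENNReal.ofReal w * logLoss y t =
      ENNReal.ofReal (w * y) * negLog t + ENNReal.ofReal (w * (1 - y)) * negLog (1 - t) := by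
  rw [logLoss, mul_add, ← mul_assoc, ← mul_assoc, ENNReal.ofReal_mul hw, ENNReal.ofReal_mul hw]

/-- Pooling does not change the total logarithmic loss. -/
theorem poolT_logLoss {a b : Pt ℝ} (ha : a.IsProper) (hb : b.IsProper) (t : ℝ) :
    ENNReal.ofReal (poolT a b).val.w * logLoss (poolT a b).val.y t =
      ENNReal.ofReal a.w * logLoss a.y t + ENNReal.ofReal b.w * logLoss b.y t := by
  have hu := poolT_isProper ha hb
  have hne : a.w + b.w ≠ 0 := (add_pos ha.1 hb.1).ne'
  rw [ofReal_mul_logLoss hu.1.le, ofReal_mul_logLoss ha.1.le, ofReal_mul_logLoss hb.1.le]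
  -- The loss depends on a point only through `w * y` and `w * (1 - y)`, and both are additive under
  -- pooling.
  have h₁ : (poolT a b).val.w * (poolT a b).val.y = a.w * a.y + b.w * b.y := by
    rw [poolT_val]
    field_simp
  have h₂ : (poolT a b).val.w * (1 - (poolT a b).val.y) =
      a.w * (1 - a.y) + b.w * (1 - b.y) := by
    rw [mul_sub, h₁, poolT_val]
    ring
  rw [h₁, h₂, ENNReal.ofReal_add (mul_nonneg ha.1.le ha.2.1) (mul_nonneg hb.1.le hb.2.1),
    ENNReal.ofReal_add (mul_nonneg ha.1.le (sub_nonneg.2 ha.2.2))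
      (mul_nonneg hb.1.le (sub_nonneg.2 hb.2.2))]
  ring

theorem mergeT_spec (X : List (Pt ℝ)) (hs : X.Pairwise Pt.LexLe) (hX : ∀ x ∈ X, x.IsProper) :
    (mergeT X).val.Pairwise Pt.LexLt ∧ (∀ z ∈ (mergeT X).val, z.IsProper) ∧
      (∀ s, s ∈ (mergeT X).val.map Pt.pos ↔ s ∈ X.map Pt.pos) ∧
      ∀ f : ℝ × ℕ → ℝ,
        ((mergeT X).val.map fun x => ENNReal.ofReal x.w * logLoss x.y (f x.pos)).sum =
          (X.map fun x => ENNReal.ofReal x.w * logLoss x.y (f x.pos)).sum := by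
  induction X with
  | nil => simp [mergeT]
  | cons x X ih =>
    rw [List.pairwise_cons] at hs
    obtain ⟨hx, hX⟩ := List.forall_mem_cons.1 hX
    obtain ⟨h₁, h₂, h₃, h₄⟩ := ih hs.2 hX
    simp only [mergeT, bind_val]
    split
    next hM =>
      simp only [hM, List.map_nil, List.not_mem_nil, false_iff] at h₃ h₄
      refine ⟨by simp, by simpa using hx, fun s => ?_, fun f => ?_⟩
      · have := h₃ s
        simp only [consT_val, List.map_cons, List.map_nil, List.mem_cons, this,
          List.not_mem_nil]
      · simp [← h₄ f]
    next z zs hM =>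
      rw [hM] at h₁ h₂ h₃ h₄
      obtain ⟨hz, hzs⟩ := List.pairwise_cons.1 h₁
      obtain ⟨hzp, hzsp⟩ := List.forall_mem_cons.1 h₂
      -- `z` may be a pooled point, but it shares its position with an original point after `x`.
      have hxz : x.LexLe z := by
        obtain ⟨x', hx', he⟩ := List.mem_map.1 ((h₃ z.pos).1 (by simp))
        have := hs.1 x' hx'
        obtain ⟨hq, hr⟩ := Prod.mk.inj he
        simpa only [Pt.LexLe, hq, hr] using this
      simp only [bind_val]
      split
      next hsame =>
        rw [samePosT_val] at hsame
        obtain ⟨hq, hr⟩ := Prod.mk.inj hsame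
        have hpos : (poolT x z).val.pos = x.pos := rfl
        simp only [bind_val, consT_val]
        refine ⟨List.pairwise_cons.2 ⟨fun a ha => ?_, hzs⟩,
          List.forall_mem_cons.2 ⟨poolT_isProper hx hzp, hzsp⟩, fun s => ?_, fun f => ?_⟩
        · have := hz a ha
          simp only [Pt.LexLt, poolT_val, hq, hr] at this ⊢
          exact this
        · rw [List.map_cons, List.map_cons, List.mem_cons, List.mem_cons, ← h₃ s, List.map_cons,
            List.mem_cons, hpos, hsame]
          tauto
        · rw [List.map_cons, List.sum_cons, List.map_cons, List.sum_cons, ← h₄ f, List.map_cons,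
            List.sum_cons, hpos, poolT_logLoss hx hzp, hsame, add_assoc]
      next hsame =>
        rw [samePosT_val] at hsame
        have hlt := hxz.lt_of_pos_ne hsame
        simp only [consT_val]
        refine ⟨List.pairwise_cons.2 ⟨List.forall_mem_cons.2 ⟨hlt, fun a ha => ?_⟩, h₁⟩,
          List.forall_mem_cons.2 ⟨hx, h₂⟩, fun s => ?_, fun f => ?_⟩
        · exact hxz.trans_lt (hz a ha)
        · rw [List.map_cons, List.map_cons (l := X), List.mem_cons, List.mem_cons, h₃ s]
        · rw [List.map_cons, List.sum_cons, List.map_cons (l := X), List.sum_cons, h₄ f]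

variable {m k : ℕ} {p y : Fin m → Fin k → ℝ} {σ : Fin m → Equiv.Perm (Fin k)}

theorem mem_collectT_inputData (hσ : ∀ i, IsOrderPerm (p i) (σ i)) {x : Pt ℝ} :
    x ∈ (collectT (inputData p y σ)).val ↔ ∃ i, ∃ r ∈ Finset.Ico 1 k,
      x = ⟨topSum (σ i) (p i) r, r, topSum (σ i) (y i) r, 1⟩ := by
  simp only [collectT_inputData p y σ hσ, List.mem_flatten, List.mem_ofFn, cumulativeData]
  constructor
  · rintro ⟨_, ⟨i, rfl⟩, hx⟩
    obtain ⟨t, ht, rfl⟩ := List.mem_map.1 hx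
    rw [List.mem_range] at ht
    exact ⟨i, t + 1, Finset.mem_Ico.2 (by lia), rfl⟩
  · rintro ⟨i, r, hr, rfl⟩
    rw [Finset.mem_Ico] at hr
    refine ⟨_, ⟨i, rfl⟩, List.mem_map.2 ⟨r - 1, List.mem_range.2 (by lia), ?_⟩⟩
    rw [Nat.sub_add_cancel hr.1]

theorem nll_eq_sum_collectT (hσ : ∀ i, IsOrderPerm (p i) (σ i)) (f : ℝ × ℕ → ℝ) :
    nll p y σ f = ((collectT (inputData p y σ)).val.map fun x =>
      ENNReal.ofReal x.w * logLoss x.y (f x.pos)).sum := by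
  rw [collectT_inputData p y σ hσ, List.map_flatten, List.sum_flatten, List.map_ofFn,
    List.map_ofFn, List.sum_ofFn, nll]
  refine Finset.sum_congr rfl fun i _ => ?_
  simp only [Function.comp_apply, cumulativeData, List.map_map]
  rw [Finset.sum_Ico_eq_sum_range, ← List.sum_toFinset _ List.nodup_range, List.toFinset_range]
  refine Finset.sum_congr rfl fun t _ => ?_
  simp [logLoss, Pt.pos, add_comm]

theorem aggregateT_spec (hσ : ∀ i, IsOrderPerm (p i) (σ i))
    (hy : ∀ i, y i ∈ stdSimplex ℝ (Fin k)) :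
    IsGrid k (aggregateT (inputData p y σ)).val ∧
      (∀ x ∈ (aggregateT (inputData p y σ)).val, x.y ∈ Set.Icc (0 : ℝ) 1) ∧
      (∀ s, s ∈ (aggregateT (inputData p y σ)).val.map Pt.pos ↔
        ∃ i, ∃ r ∈ Finset.Ico 1 k, s = (topSum (σ i) (p i) r, r)) ∧
      ∀ f, nll p y σ f = ((aggregateT (inputData p y σ)).val.map fun x =>
        ENNReal.ofReal x.w * logLoss x.y (f x.pos)).sum := by
  have hperm := sortT_perm ptBeforeT (collectT (inputData p y σ)).val
  obtain ⟨h₁, h₂, h₃, h₄⟩ := mergeT_spec _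
    (sortT_ptBeforeT_pairwise (collectT (inputData p y σ)).val) fun x hx => by
      obtain ⟨i, r, -, rfl⟩ := (mem_collectT_inputData hσ).1 (hperm.mem_iff.1 hx)
      exact ⟨one_pos, topSum_mem_Icc (σ i) (hy i) r⟩
  have hagg : (aggregateT (inputData p y σ)).val =
      (mergeT (sortT ptBeforeT (collectT (inputData p y σ)).val).val).val := rfl
  rw [← hagg] at h₁ h₂ h₃ h₄
  have hpos : ∀ s, s ∈ (aggregateT (inputData p y σ)).val.map Pt.pos ↔
      ∃ i, ∃ r ∈ Finset.Ico 1 k, s = (topSum (σ i) (p i) r, r) := fun s => by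
    rw [h₃, (hperm.map Pt.pos).mem_iff, List.mem_map]
    constructor
    · rintro ⟨x, hx, rfl⟩
      obtain ⟨i, r, hr, rfl⟩ := (mem_collectT_inputData hσ).1 hx
      exact ⟨i, r, hr, rfl⟩
    · rintro ⟨i, r, hr, rfl⟩
      exact ⟨_, (mem_collectT_inputData hσ).2 ⟨i, r, hr, rfl⟩, rfl⟩
  refine ⟨⟨h₁, fun x hx => ?_⟩, fun x hx => (h₂ x hx).2, hpos, fun f => ?_⟩
  · obtain ⟨i, r, hr, he⟩ := (hpos x.pos).1 (List.mem_map_of_mem hx)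
    obtain ⟨-, hxr⟩ := Prod.mk.inj he
    rw [Finset.mem_Ico, ← hxr] at hr
    exact ⟨hr.1, hr.2, (h₂ x hx).1⟩
  · rw [nll_eq_sum_collectT hσ, h₄, (hperm.map _).sum_eq]

end Aggregation

/-! ### The whole method -/

section Method

open scoped Classical

/-- A bounded isotonic function on the data positions extends to the whole domain. -/
theorem exists_monotone_extension_Icc {X : List (Pt ℝ)} {g : ℝ × ℕ → ℝ} (hg : IsotonicOn X g)
    (hI : ∀ x ∈ X, g x.pos ∈ Set.Icc (0 : ℝ) 1) :
    ∃ f : ℝ × ℕ → ℝ, Monotone f ∧ (∀ s, f s ∈ Set.Icc (0 : ℝ) 1) ∧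
      ∀ x ∈ X, f x.pos = g x.pos := by
  -- The extension is the supremum of the fitted values at data positions below `s`; 0 is added for
  -- the case that there are none.
  set A : ℝ × ℕ → Set ℝ := fun s => insert 0 {t | ∃ x ∈ X, x.pos ≤ s ∧ g x.pos = t} with hA
  have hle : ∀ s, ∀ t ∈ A s, t ≤ 1 := by
    rintro s t (rfl | ⟨x, hx, -, rfl⟩)
    · exact zero_le_one
    · exact (hI x hx).2
  have hbdd : ∀ s, BddAbove (A s) := fun s => ⟨1, hle s⟩
  have h₀ : ∀ s, (0 : ℝ) ∈ A s := fun s => Set.mem_insert _ _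
  refine ⟨fun s => sSup (A s), fun s t hst => ?_, fun s => ?_, fun x hx => ?_⟩
  · refine csSup_le_csSup (hbdd t) ⟨0, h₀ s⟩ (Set.insert_subset_insert ?_)
    rintro _ ⟨x, hx, hxs, rfl⟩
    exact ⟨x, hx, hxs.trans hst, rfl⟩
  · exact ⟨le_csSup (hbdd s) (h₀ s), csSup_le ⟨0, h₀ s⟩ (hle s)⟩
  · refine le_antisymm (csSup_le ⟨0, h₀ _⟩ ?_) (le_csSup (hbdd _) (Or.inr ⟨x, hx, le_rfl, rfl⟩))
    rintro t (rfl | ⟨z, hz, hzx, rfl⟩)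
    · exact (hI x hx).1
    · exact hg z hz x hx hzx

/-- Recursive splitting solves the isotonic regression problem for the logarithmic loss. -/
theorem splitSolveT_logLoss {k : ℕ} {X : List (Pt ℝ)} (hX : IsGrid k X)
    (hy : ∀ x ∈ X, x.y ∈ Set.Icc (0 : ℝ) 1) :
    ∃ g : ℝ × ℕ → ℝ, Monotone g ∧ (∀ s, g s ∈ Set.Icc (0 : ℝ) 1) ∧
      (∀ f, IsotonicOn X f →
        (X.map fun x => ENNReal.ofReal x.w * logLoss x.y (g x.pos)).sum ≤
          (X.map fun x => ENNReal.ofReal x.w * logLoss x.y (f x.pos)).sum) ∧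
      (splitSolveT k X.length X).val.Perm (X.map fun x => (x.pos, g x.pos)) ∧
      (splitSolveT k X.length X).steps ≤ 60 * (X.length ^ 2 * k) := by
  -- The empty list does occur in the method: for `k = 1` there are no ranks.
  by_cases hX₀ : X = []
  · subst hX₀
    exact ⟨fun _ => 0, monotone_const, by simp, by simp, by simp [splitSolveT],
      by simp [splitSolveT]⟩
  obtain ⟨g, hg, hperm, hsteps⟩ := splitSolveT_spec X.length X le_rfl hX₀ hX
  have hy' : ∀ x ∈ X.toFinset, x.y ∈ Set.Icc (0 : ℝ) 1 := fun x hx => hy x (List.mem_toFinset.1 hx)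
  obtain ⟨f, hf, hfI, hfg⟩ := exists_monotone_extension_Icc
    (isotonicOn_iff.2 (hg.isotonic hX.pos_weight_toFinset)) fun x hx =>
      hg.mem_Icc hX.pos_weight_toFinset hy' x (List.mem_toFinset.2 hx)
  have hf' := hg.congr fun x hx => hfg x (List.mem_toFinset.1 hx)
  refine ⟨f, hf, hfI, fun h hh => ?_, hperm.trans (List.Perm.of_eq ?_), hsteps⟩
  · rw [← List.sum_toFinset _ hX.nodup, ← List.sum_toFinset _ hX.nodup]
    exact hf'.sum_logLoss_le hX.pos_weight_toFinset hy' (isotonicOn_iff.1 hh)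
  · exact List.map_congr_left fun x hx => by rw [hfg x hx]

variable {m k : ℕ} {p y : Fin m → Fin k → ℝ} {σ : Fin m → Equiv.Perm (Fin k)}

theorem length_of_mem_inputData : ∀ s ∈ inputData p y σ, s.length = k := by
  simp [inputData]

theorem length_inputData : (inputData p y σ).length = m := by simp [inputData]

theorem fitT_spec (hm : 0 < m) (hk : 0 < k) (hσ : ∀ i, IsOrderPerm (p i) (σ i))
    (hp : ∀ i, p i ∈ stdSimplex ℝ (Fin k)) (hy : ∀ i, y i ∈ stdSimplex ℝ (Fin k)) :
    (∃ g, IsSolution p y σ g ∧ ∀ e, e ∈ (fitT k (inputData p y σ)).val ↔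
      ∃ i, ∃ r ∈ Finset.Ico 1 k,
        e = ((topSum (σ i) (p i) r, r), g (topSum (σ i) (p i) r, r))) ∧
    (fitT k (inputData p y σ)).steps ≤ 100 * (m ^ 2 * k ^ 4) := by
  obtain ⟨hgrid, hval, hpos, hnll⟩ := aggregateT_spec hσ hy
  have hlen := aggregateT_length_le k (inputData p y σ) length_of_mem_inputData
  have hagg := aggregateT_steps_le k (inputData p y σ) length_of_mem_inputData hk
    (List.length_pos_iff.1 (by rwa [length_inputData]))
  rw [length_inputData] at hlen hagg
  have hfit : fitT k (inputData p y σ) = (do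
    tick
    let X ← aggregateT (inputData p y σ)
    splitSolveT k X.length X) := rfl
  rw [hfit]
  simp only [bind_val, bind_steps, tick_steps]
  generalize (aggregateT (inputData p y σ)).val = X at *
  obtain ⟨g, hg, hgI, hmin, hperm, hsteps⟩ := splitSolveT_logLoss hgrid hval
  refine ⟨⟨g, ⟨⟨fun s _ => hgI s, hg.monotoneOn _⟩, fun h hh => ?_⟩, fun e => ?_⟩, ?_⟩
  · rw [hnll, hnll]
    have hdom : ∀ x ∈ X, x.pos ∈ domain k := fun x hx => by
      obtain ⟨i, r, hr, he⟩ := (hpos x.pos).1 (List.mem_map_of_mem hx)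
      rw [he]
      exact ⟨topSum_mem_Icc (σ i) (hp i) r, Finset.mem_Ico.1 hr⟩
    exact hmin h fun x hx z hz hxz => hh.2 (hdom x hx) (hdom z hz) hxz
  · rw [hperm.mem_iff]
    have : (X.map fun x => (x.pos, g x.pos)) = (X.map Pt.pos).map fun s => (s, g s) := by
      rw [List.map_map]
      rfl
    rw [this, List.mem_map]
    constructor
    · rintro ⟨s, hs, rfl⟩
      obtain ⟨i, r, hr, rfl⟩ := (hpos s).1 hs
      exact ⟨i, r, hr, rfl⟩
    · rintro ⟨i, r, hr, rfl⟩
      exact ⟨_, (hpos _).2 ⟨i, r, hr, rfl⟩, rfl⟩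
  -- Splitting at most `m (k - 1)` points costs at most `60 m ^ 2 k ^ 3`, relaxed here to `k ^ 4`.
  -- With 33 for aggregation and 1 for the call, the constant is at most 94.
  · have h₁ : X.length ^ 2 * k ≤ m ^ 2 * k ^ 4 := by
      calc X.length ^ 2 * k ≤ (m * k) ^ 2 * k ^ 2 := by
            gcongr
            · exact hlen.trans (by gcongr; lia)
            · exact Nat.le_self_pow (by simp) _
        _ = m ^ 2 * k ^ 4 := by ring
    have h₂ : m ^ 2 * k ^ 2 ≤ m ^ 2 * k ^ 4 := by
      gcongr 1
      exact Nat.pow_le_pow_right hk (by norm_num)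
    have h₃ : 0 < m ^ 2 * k ^ 4 := by positivity
    lia

end Method

end SCIR

/-! ### The main theorem -/

theorem mainTheorem1 :
    ∃ C : ℕ,
      -- every run of the dynamic program yields a maximal upper set, in linear time in the table
      (∀ (k : ℕ) (X : List (SCIR.Pt ℝ)), X ≠ [] → SCIR.IsGrid k X →
        ∀ L U : List (SCIR.Pt ℝ), (SCIR.maxUpperSetT k X).val = (L, U) →
          (L ++ U).Perm X ∧ L.Sublist X ∧ SCIR.IsMaximalUpperSet X U ∧
          (L ≠ [] → U ≠ [] → SCIR.IsProjectionPair X L U) ∧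
          (SCIR.maxUpperSetT k X).steps ≤ C * (X.length * k)) ∧
      -- the whole method, for every calibration set
      (∀ (m k : ℕ), 0 < m → ∀ (p : Fin m → Fin k → ℝ) (label : Fin m → Fin k)
        (σ : Fin m → Equiv.Perm (Fin k)),
        (∀ i, p i ∈ stdSimplex ℝ (Fin k)) → (∀ i, SCIR.IsOrderPerm (p i) (σ i)) →
        ∀ y : Fin m → Fin k → ℝ, (∀ i, y i = SCIR.oneHot (label i)) →
          -- the dynamic program is applied to sublists of a grid of at most `m (k-1)` points
          SCIR.IsGrid k (SCIR.aggregateT (SCIR.inputData p y σ)).val ∧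
          (SCIR.aggregateT (SCIR.inputData p y σ)).val.length ≤ m * (k - 1) ∧
          -- the output is a solution of the problem, tabulated at the data positions
          (∃ g : ℝ × ℕ → ℝ, SCIR.IsSolution p y σ g ∧
            ∀ e : (ℝ × ℕ) × ℝ, e ∈ (SCIR.fitT k (SCIR.inputData p y σ)).val ↔
              ∃ i : Fin m, ∃ r ∈ Finset.Ico 1 k,
                e = ((SCIR.topSum (σ i) (p i) r, r), g (SCIR.topSum (σ i) (p i) r, r))) ∧
          (SCIR.fitT k (SCIR.inputData p y σ)).steps ≤ C * (m ^ 2 * k ^ 4)) := by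
  -- The constant is that of the whole method; a single split needs only 40.
  refine ⟨100, fun k X hX₀ hX L U h => ?_, fun m k hm p label σ hp hσ y hy => ?_⟩
  · obtain ⟨hLU, hL, hU⟩ := SCIR.maxUpperSetT_spec hX hX₀ h
    refine ⟨hLU, hL, hU, hU.isProjectionPair hX hLU hL, ?_⟩
    have hk : 0 < k := by
      obtain ⟨x, hx⟩ := List.exists_mem_of_ne_nil X hX₀
      exact Nat.zero_lt_of_lt (hX.2 x hx).2.1
    exact (SCIR.maxUpperSetT_steps_le k hk X hX₀).trans (Nat.mul_le_mul_right _ (by norm_num))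
  · have hy' : ∀ i, y i ∈ stdSimplex ℝ (Fin k) := fun i =>
      hy i ▸ SCIR.oneHot_mem_stdSimplex (label i)
    have hk : 0 < k := Fin.pos (label ⟨0, hm⟩)
    obtain ⟨hsol, hsteps⟩ := SCIR.fitT_spec hm hk hσ hp hy'
    refine ⟨(SCIR.aggregateT_spec hσ hy').1, ?_, hsol, hsteps⟩
    have := SCIR.aggregateT_length_le k _ (SCIR.length_of_mem_inputData (p := p) (y := y) (σ := σ))
    rwa [SCIR.length_inputData] at this
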